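/- Let $P\ge 0$ be an integer and let $h_*:\mathbb R^P\to\mathbb R$ be a nonzero polynomial, written in the basis of products of probabilists' Hermite polynomials as $$h_*(z)=\sum_{S=(k_1,\dots,k_P)\in\mathbb N^P}\hat h_*(S)\prod_{i=1}^P \mathrm{He}_{k_i}(z_i),$$ where finitely many and at least one of the coefficients $\hat h_*(S)$ are nonzero, and let $D=\max\{\sum_i k_i:\hat h_*(S)\ne 0\}$ be its degree. For $d\ge P$ and a semi-orthogonal matrix $M\in\mathbb R^{P\times d}$, $MM^\top=I_P$, put $f_{*,M}(x)=h_*(Mx)$ for $x\in\mathbb R^d$. A linear method with $n$ samples is given by a real Hilbert space $\mathcal H$, a (weakly measurable) feature map $\psi:\mathbb R^d\to\mathcal H$, a loss $L:\mathbb R^{2n}\to\mathbb R\cup\{\infty\}$ and a parameter $\lambda>0$. On data $(x_i,y_i)_{i\le n}$ it outputs $\hat f(x)=\langle\hat a,\psi(x)\rangle_{\mathcal H}$, where $\hat a$ is a minimizer over $a\in\mathcal H$ of $$L\big((y_i,\langle a,\psi(x_i)\rangle)_{i\le n}\big)+\lambda\|a\|_{\mathcal H}^2,$$ the minimum being assumed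 to be attained and finite. There are constants $c_{h_*},C_{h_*}>0$ depending only on $h_*$ such that the following holds for all $d\ge P$, all $n\ge 0$, every linear method with $n$ samples, all sample points $x_1,\dots,x_n\in\mathbb R^d$ not depending on $M$, and all real noise values $\epsilon_1,\dots,\epsilon_n$, which may depend on $M$. For each semi-orthogonal $M$ let $\hat f_M$ be an output of the method on the samples $(x_i,f_{*,M}(x_i)+\epsilon_i)_{i\le n}$. Then, with $M$ uniformly distributed on $\{M\in\mathbb R^{P\times d}:MM^\top=I_P\}$, $$\mathbb E_M\Big[\mathbb E_{x\sim\mathsf N(0,I_d)}\big[(f_{*,M}(x)-\hat f_M(x))^2\big]\Big]\;\ge\; c_{h_*}-C_{h_*}\min(n,\dim\mathcal H)\,d^{-D},$$ where the expectations may be infinite and $\min(n,\dim\mathcal H)=n$ if $\dim\mathcal H=\infty$. (If $M\mapsto\mathbb E_x[(f_{*,M}(x)-\hat f_M(x))^2]$ is not measurable, $\mathbb E_M$ is read as the lower integral.) -/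

import Mathlib

open MeasureTheory ProbabilityTheory

noncomputable section

namespace LinearLowerBound

/-- The function `h : ℝ^P → ℝ`, `h z = ∑_k c_k ∏_i He_{k_i}(z_i)`, given by a finite family `c` of
coefficients in the basis of products of probabilists' Hermite polynomials. -/
def hermiteSum {P : ℕ} (c : (Fin P → ℕ) →₀ ℝ) (z : Fin P → ℝ) : ℝ :=
  c.sum fun k a => a * ∏ i, Polynomial.aeval (z i) (Polynomial.hermite (k i))

/-- The degree `max {∑ i, k i | c k ≠ 0}` (meaningful for `c ≠ 0`). -/
def hermiteDegree {P : ℕ} (c : (Fin P → ℕ) →₀ ℝ) : ℕ :=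
  c.support.sup fun k => ∑ i, k i

/-- The multi-index function `x ↦ h (M x)` on `ℝ^d`. -/
def target {P d : ℕ} (c : (Fin P → ℕ) →₀ ℝ) (M : Matrix (Fin P) (Fin d) ℝ) (x : Fin d → ℝ) : ℝ :=
  hermiteSum c (M.mulVec x)

/-- The Gaussian distribution `N(0, I_d)` on `ℝ^d`. -/
def gaussian (d : ℕ) : Measure (Fin d → ℝ) :=
  Measure.pi fun _ => gaussianReal 0 1

instance instMeasurableSpaceMatrix (m n : ℕ) : MeasurableSpace (Matrix (Fin m) (Fin n) ℝ) :=
  MeasurableSpace.pi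

instance instBorelSpaceMatrix (m n : ℕ) : BorelSpace (Matrix (Fin m) (Fin n) ℝ) :=
  inferInstanceAs (BorelSpace (Fin m → Fin n → ℝ))

instance instCompactSpaceOrthogonalGroup (d : ℕ) :
    CompactSpace (Matrix.orthogonalGroup (Fin d) ℝ) := by
  refine isCompact_iff_compactSpace.mp
    (?_ : IsCompact (Matrix.orthogonalGroup (Fin d) ℝ : Set (Matrix (Fin d) (Fin d) ℝ)))
  have hK : IsCompact (Set.univ.pi fun _ : Fin d => Set.univ.pi fun _ : Fin d =>
      Metric.closedBall (0 : ℝ) 1) :=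
    isCompact_univ_pi fun _ => isCompact_univ_pi fun _ => isCompact_closedBall _ _
  have hc : IsClosed {U : Matrix (Fin d) (Fin d) ℝ | U * star U = 1} :=
    isClosed_eq (by fun_prop) continuous_const
  refine hK.of_isClosed_subset ?_ ?_
  · have he : (Matrix.orthogonalGroup (Fin d) ℝ : Set (Matrix (Fin d) (Fin d) ℝ))
        = {U | U * star U = 1} :=
      Set.ext fun U => Matrix.mem_orthogonalGroup_iff (Fin d) ℝ
    exact he ▸ hc
  · intro U hU i _ j _
    simpa using entry_norm_bound_of_unitary (𝕜 := ℝ) hU i j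

/-- The uniform distribution on the semi-orthogonal matrices `M ∈ ℝ^{P × d}`, `M Mᵀ = I_P`: the law
of the first `P` rows of a random matrix distributed according to the normalized Haar measure of
the orthogonal group `O(d)`. -/
def uniformSemiOrthogonal {P d : ℕ} (hPd : P ≤ d) : Measure (Matrix (Fin P) (Fin d) ℝ) :=
  (Measure.haarMeasure (⊤ : TopologicalSpace.PositiveCompacts (Matrix.orthogonalGroup (Fin d) ℝ))).map
    fun Q => Q.1.submatrix (Fin.castLE hPd) id

section LinearMethod

variable {d n : ℕ} {H : Type*} [NormedAddCommGroup H] [InnerProductSpace ℝ H]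

/-- The regularized empirical risk `L((y_i, ⟨a, ψ(x_i)⟩)_{i ≤ n}) + lam * ‖a‖²` of the weights `a`,
for a feature map `ψ` and a loss `L : ℝ^{2n} → ℝ ∪ {∞}`. -/
def regularizedRisk (ψ : (Fin d → ℝ) → H) (L : (Fin n → ℝ × ℝ) → WithTop ℝ) (lam : ℝ)
    (x : Fin n → Fin d → ℝ) (y : Fin n → ℝ) (a : H) : WithTop ℝ :=
  L (fun i => (y i, inner ℝ a (ψ (x i)))) + ((lam * ‖a‖ ^ 2 : ℝ) : WithTop ℝ)

/-- `a` is an output of the linear method on the data `(y_i, x_i)`: a minimizer of the regularized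
empirical risk. Its risk is required to be finite, since otherwise the risk is identically `∞`
and every vector of `H` would be a minimizer. -/
def IsLinearMethodOutput (ψ : (Fin d → ℝ) → H) (L : (Fin n → ℝ × ℝ) → WithTop ℝ) (lam : ℝ)
    (x : Fin n → Fin d → ℝ) (y : Fin n → ℝ) (a : H) : Prop :=
  regularizedRisk ψ L lam x y a < ⊤ ∧
    ∀ b : H, regularizedRisk ψ L lam x y a ≤ regularizedRisk ψ L lam x y b

end LinearMethod

end LinearLowerBound

end

namespace LinearLowerBound

/-! The regularizer forces every output into `V`, the span of the features at the sample points.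
This space does not depend on `M` or on the noise, and its dimension is at most `min(n, dim H)`
(`IsLinearMethodOutput.mem_span`, `finrank_span_range_le`). It therefore suffices to show that no
fixed space of small dimension approximates most of the targets.

The error is tested against the monomials `∏ s ∈ S, x s` with `|S| = D`, which are orthonormal under
the Gaussian. Integrating by parts `D` times shows that the coefficients of the target are entries
of its leading derivative tensor contracted with copies of `M` (`integral_target_mul_prod`). For
uniform `M`, sign flips and permutations of the columns make this random coefficient vector
isotropic, with covariance `σ I` (`integral_inner_multilinearPart_sq`). The square-integrable
predictors from `V` have coefficient vectors in a subspace `U` with `dim U ≤ dim V`, so the expected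
risk is at least `σ * dim Uᗮ ≥ σ * (d.choose D - dim V)` (`ofReal_choose_sub_mul_le_lintegral`).

It remains to see that `σ` is at least of order `d ^ (-D)` (`exists_le_integral_contraction_sq`).
The squared entries of the full contracted tensor add up to a positive constant, and those at
multi-indices with a repetition contribute only `O(1/d)` by a fourth moment bound. The finitely many
small `d` are absorbed into the constants: one sample makes the bound vacuous, and without samples
the predictor is zero. -/

/-! ### Gaussian moments and integration by parts -/

theorem integrable_pow_gaussianReal (n : ℕ) :
    Integrable (fun x : ℝ => x ^ n) (gaussianReal 0 1) := by
  have h := (memLp_id_gaussianReal (μ := 0) (v := 1) (n : NNReal)).integrable_norm_pow'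
  refine h.mono (by fun_prop) (Filter.Eventually.of_forall fun x => ?_)
  simp

/-- The standard Gaussian density satisfies `φ' = -x φ`; integrate `x ^ n * φ'` by parts. At `n = 0`
the truncated exponent `n - 1` is harmless because of the factor `n`. -/
theorem integral_pow_succ_gaussianReal (n : ℕ) :
    ∫ x : ℝ, x ^ (n + 1) ∂(gaussianReal 0 1) = n * ∫ x : ℝ, x ^ (n - 1) ∂(gaussianReal 0 1) := by
  have hint : ∀ k : ℕ, Integrable (fun x : ℝ => x ^ k * gaussianPDFReal 0 1 x) := by
    intro k
    have h := integrable_pow_gaussianReal k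
    rw [gaussianReal_of_var_ne_zero 0 one_ne_zero,
      integrable_withDensity_iff (measurable_gaussianPDF 0 1)
        (Filter.Eventually.of_forall fun x => by simp [gaussianPDF])] at h
    simpa [gaussianPDF, ENNReal.toReal_ofReal (gaussianPDFReal_nonneg 0 1 _)] using h
  have hd : ∀ x : ℝ, HasDerivAt (gaussianPDFReal 0 1) (-x * gaussianPDFReal 0 1 x) x := by
    intro x
    have h1 : HasDerivAt (fun y : ℝ => -(y - 0) ^ 2 / (2 * ((1 : NNReal) : ℝ))) (-x) x := by
      have := (((hasDerivAt_id x).sub_const 0).pow 2).neg.div_const (2 * ((1 : NNReal) : ℝ))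
      refine this.congr_deriv ?_
      simp
      ring
    have h2 := (h1.exp).const_mul (Real.sqrt (2 * Real.pi * ((1 : NNReal) : ℝ)))⁻¹
    refine h2.congr_deriv ?_
    rw [gaussianPDFReal]
    ring
  have key := integral_mul_deriv_eq_deriv_mul_of_integrable
    (u := fun x : ℝ => x ^ n) (v := gaussianPDFReal 0 1)
    (u' := fun x : ℝ => n * x ^ (n - 1)) (v' := fun x => -x * gaussianPDFReal 0 1 x)
    (fun x _ => by simpa using hasDerivAt_pow n x) (fun x _ => hd x)
    (by
      refine (hint (n + 1)).neg.congr (Filter.Eventually.of_forall fun x => ?_)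
      simp only [Pi.neg_apply, Pi.mul_apply]
      ring)
    (by
      refine ((hint (n - 1)).const_mul (n : ℝ)).congr (Filter.Eventually.of_forall fun x => ?_)
      simp only [Pi.mul_apply]
      ring)
    (hint n)
  rw [integral_gaussianReal_eq_integral_smul one_ne_zero,
    integral_gaussianReal_eq_integral_smul one_ne_zero, ← integral_const_mul]
  have e1 : ∫ x, gaussianPDFReal 0 1 x • x ^ (n + 1)
      = -∫ x, x ^ n * (-x * gaussianPDFReal 0 1 x) := by
    rw [← integral_neg]
    congr 1
    ext x
    simp only [smul_eq_mul]
    ring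
  rw [e1, key, neg_neg]
  congr 1
  ext x
  simp only [smul_eq_mul]
  ring

instance instIsProbabilityMeasureGaussian (d : ℕ) : IsProbabilityMeasure (gaussian d) := by
  unfold gaussian
  infer_instance

section GaussianPolynomial

variable {d : ℕ}

open MvPolynomial

theorem eval_monomial_eq_prod (x : Fin d → ℝ) (m : Fin d →₀ ℕ) (a : ℝ) :
    eval x (monomial m a) = a * ∏ i, x i ^ m i := by
  rw [eval_monomial, Finsupp.prod_fintype _ _ fun i => pow_zero _]

theorem integrable_eval_gaussian (q : MvPolynomial (Fin d) ℝ) :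
    Integrable (fun x => eval x q) (gaussian d) := by
  induction q using MvPolynomial.induction_on' with
  | monomial m a =>
    simp only [eval_monomial_eq_prod]
    exact (Integrable.fintype_prod (f := fun i (t : ℝ) => t ^ m i)
      fun i => integrable_pow_gaussianReal (m i)).const_mul a
  | add p q hp hq =>
    simp only [map_add]
    exact hp.add hq

theorem memLp_eval_gaussian (q : MvPolynomial (Fin d) ℝ) :
    MemLp (fun x => eval x q) 2 (gaussian d) := by
  refine (memLp_two_iff_integrable_sq (integrable_eval_gaussian q).aestronglyMeasurable).2 ?_
  exact (integrable_eval_gaussian (q ^ 2)).congr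
    (Filter.Eventually.of_forall fun x => map_pow (eval x) q 2)

theorem integral_eval_monomial_gaussian (m : Fin d →₀ ℕ) (a : ℝ) :
    ∫ x, eval x (monomial m a) ∂(gaussian d)
      = a * ∏ i, ∫ t : ℝ, t ^ m i ∂(gaussianReal 0 1) := by
  simp only [eval_monomial_eq_prod, integral_const_mul]
  congr 1
  exact integral_fintype_prod_eq_prod (fun i (t : ℝ) => t ^ m i)

/-- Gaussian integration by parts for polynomials. -/
theorem integral_mul_eval_gaussian (i : Fin d) (q : MvPolynomial (Fin d) ℝ) :
    ∫ x, x i * eval x q ∂(gaussian d) = ∫ x, eval x (pderiv i q) ∂(gaussian d) := by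
  have hX : ∀ (q : MvPolynomial (Fin d) ℝ), (fun x : Fin d → ℝ => x i * eval x q)
      = fun x => eval x (X i * q) := fun q => by
    ext x
    simp
  rw [hX]
  induction q using MvPolynomial.induction_on' with
  | monomial m a =>
    rw [pderiv_monomial, X, monomial_mul, one_mul, integral_eval_monomial_gaussian,
      integral_eval_monomial_gaussian, mul_assoc,
      ← Finset.mul_prod_erase Finset.univ _ (Finset.mem_univ i),
      ← Finset.mul_prod_erase Finset.univ _ (Finset.mem_univ i), ← mul_assoc (m i : ℝ)]
    congr 2
    · have := integral_pow_succ_gaussianReal (m i)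
      simpa [add_comm] using this
    · refine Finset.prod_congr rfl fun j hj => ?_
      have hji : i ≠ j := (Finset.ne_of_mem_erase hj).symm
      simp [hji]
  | add p q hp hq =>
    simp only [mul_add, map_add]
    rw [integral_add (integrable_eval_gaussian _) (integrable_eval_gaussian _),
      integral_add (integrable_eval_gaussian _) (integrable_eval_gaussian _), hp, hq]

end GaussianPolynomial

/-! ### Correlation of `h (M x)` with multilinear monomials -/

section Tensor

open MvPolynomial

variable {P d : ℕ}

/-- The polynomial `h (M x)` in `x`. -/
noncomputable def compMatrix (M : Matrix (Fin P) (Fin d) ℝ) :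
    MvPolynomial (Fin P) ℝ →ₐ[ℝ] MvPolynomial (Fin d) ℝ :=
  aeval fun p => ∑ s, C (M p s) * X s

theorem eval_compMatrix (M : Matrix (Fin P) (Fin d) ℝ) (h : MvPolynomial (Fin P) ℝ)
    (x : Fin d → ℝ) : eval x (compMatrix M h) = eval (M.mulVec x) h := by
  induction h using MvPolynomial.induction_on with
  | C a => simp [compMatrix]
  | add p q hp hq => simp only [map_add, hp, hq]
  | mul_X p i hp =>
    rw [map_mul, map_mul, hp, map_mul, eval_X]
    simp [compMatrix, Matrix.mulVec, dotProduct]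

theorem pderiv_compMatrix (M : Matrix (Fin P) (Fin d) ℝ) (h : MvPolynomial (Fin P) ℝ)
    (s : Fin d) : pderiv s (compMatrix M h) = ∑ p, C (M p s) * compMatrix M (pderiv p h) := by
  induction h using MvPolynomial.induction_on with
  | C a => simp [compMatrix]
  | add p q hp hq => simp only [map_add, hp, hq, mul_add, Finset.sum_add_distrib]
  | mul_X f i hf =>
    have hX : pderiv s (compMatrix M (X i)) = C (M i s) := by
      simp [compMatrix, pderiv_X, Pi.single_apply]
    simp only [map_mul, pderiv_mul, hf, hX, map_add, pderiv_X, Pi.single_apply, mul_add,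
      Finset.sum_add_distrib, Finset.sum_mul]
    congr 1
    · exact Finset.sum_congr rfl fun p _ => by ring
    · rw [Finset.sum_eq_single i]
      · simp [mul_comm]
      · intro b _ hb
        simp [hb.symm]
      · simp

/-- The tensor of the partial derivatives of order `D` of a polynomial, evaluated at `0`. -/
noncomputable def derivTensor : (D : ℕ) → MvPolynomial (Fin P) ℝ → (Fin D → Fin P) → ℝ
  | 0, h, _ => coeff 0 h
  | D + 1, h, j => derivTensor D (pderiv (j 0) h) (Fin.tail j)

theorem coeff_pderiv_eq_zero {h : MvPolynomial (Fin P) ℝ} {D : ℕ}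
    (hD : ∀ m : Fin P →₀ ℕ, D + 1 < ∑ p, m p → coeff m h = 0) (p : Fin P) (m : Fin P →₀ ℕ)
    (hm : D < ∑ p, m p) : coeff m (pderiv p h) = 0 := by
  rw [coeff_pderiv, hD, zero_mul]
  simpa [Finset.sum_add_distrib, Finsupp.single_apply] using hm

theorem eq_C_of_coeff_eq_zero {h : MvPolynomial (Fin P) ℝ}
    (hD : ∀ m : Fin P →₀ ℕ, 0 < ∑ p, m p → coeff m h = 0) : h = C (coeff 0 h) := by
  ext m
  rw [coeff_C]
  split_ifs with hm
  · rw [hm]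
  · refine hD m (Nat.pos_of_ne_zero fun h0 => hm ?_)
    ext p
    simpa using (Finset.sum_eq_zero_iff.1 h0 p (Finset.mem_univ p)).symm

/-- Integration by parts trades the factor `x (i 0)` for a derivative. Injectivity of `i` keeps it
off the other factors, so it falls on `h (M x)`, where the chain rule produces a row index `p` and
the weight `M p (i 0)`. After `D` rounds the degree bound leaves only a constant. -/
theorem integral_eval_mulVec_mul_prod (M : Matrix (Fin P) (Fin d) ℝ) :
    ∀ (D : ℕ) (h : MvPolynomial (Fin P) ℝ) (_ : ∀ m : Fin P →₀ ℕ, D < ∑ p, m p → coeff m h = 0) (i : Fin D → Fin d)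
      (_ : Function.Injective i),
      ∫ x, eval (M.mulVec x) h * ∏ k, x (i k) ∂(gaussian d)
        = ∑ j : Fin D → Fin P, derivTensor D h j * ∏ k, M (j k) (i k)
  | 0, h, hD, i, hi => by
    rw [eq_C_of_coeff_eq_zero hD]
    simp [derivTensor]
  | D + 1, h, hD, i, hi => by
    have hti : Function.Injective (Fin.tail i) := fun a b hab => Fin.succ_injective _ (hi hab)
    have h1 : ∀ x : Fin d → ℝ, eval (M.mulVec x) h * ∏ k, x (i k)
        = x (i 0) * eval x (compMatrix M h * ∏ k : Fin D, X (i k.succ)) := by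
      intro x
      rw [Fin.prod_univ_succ, map_mul, eval_compMatrix, map_prod]
      simp only [eval_X]
      ring
    have h0 : pderiv (i 0) (∏ k : Fin D, X (i k.succ) : MvPolynomial (Fin d) ℝ) = 0 := by
      refine Finset.prod_induction _ (fun q => pderiv (i 0) q = 0)
        (fun a b ha hb => by simp [ha, hb]) pderiv_one fun k _ => ?_
      exact pderiv_X_of_ne fun he => Fin.succ_ne_zero k (hi he)
    have h2 : ∀ x : Fin d → ℝ,
        eval x (pderiv (i 0) (compMatrix M h * ∏ k : Fin D, X (i k.succ)))
          = ∑ p, M p (i 0) * (eval (M.mulVec x) (pderiv p h) * ∏ k, x (Fin.tail i k)) := by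
      intro x
      rw [pderiv_mul, h0, mul_zero, add_zero, pderiv_compMatrix, map_mul, map_sum, Finset.sum_mul]
      refine Finset.sum_congr rfl fun p _ => ?_
      rw [map_mul, eval_C, eval_compMatrix, map_prod]
      simp only [eval_X, Fin.tail]
      ring
    simp only [h1]
    rw [integral_mul_eval_gaussian]
    simp only [h2]
    rw [integral_finsetSum]
    · simp only [integral_const_mul]
      rw [← (Fin.consEquiv fun _ => Fin P).sum_comp, Fintype.sum_prod_type]
      refine Finset.sum_congr rfl fun p _ => ?_
      rw [integral_eval_mulVec_mul_prod M D _ (coeff_pderiv_eq_zero hD p) _ hti,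
        Finset.mul_sum]
      refine Finset.sum_congr rfl fun j _ => ?_
      have hj : (Fin.consEquiv fun _ => Fin P) (p, j) = Fin.cons p j := rfl
      simp only [hj, derivTensor, Fin.cons_zero, Fin.tail_cons, Fin.prod_univ_succ,
        Fin.cons_succ]
      simp only [Fin.tail]
      ring
    · intro p _
      have := integrable_eval_gaussian (compMatrix M (pderiv p h) * ∏ k, X (Fin.tail i k))
      simp only [map_mul, eval_compMatrix, map_prod, eval_X] at this
      exact this.const_mul _

/-- Differentiating along the variables of a degree `D` monomial, with multiplicity, multiplies its
coefficient by positive integers and moves it to the constant term. -/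
theorem exists_derivTensor_ne_zero :
    ∀ (D : ℕ) (h : MvPolynomial (Fin P) ℝ) (k : Fin P →₀ ℕ) (_ : ∑ p, k p = D)
      (_ : coeff k h ≠ 0), ∃ j, derivTensor D h j ≠ 0
  | 0, h, k, hk, hc => by
    have : k = 0 := by
      ext p
      simpa using Finset.sum_eq_zero_iff.1 hk p
    exact ⟨Fin.elim0, by simpa [derivTensor, this] using hc⟩
  | D + 1, h, k, hk, hc => by
    obtain ⟨p, hp⟩ : ∃ p, k p ≠ 0 := by
      by_contra! h0
      simp [h0] at hk
    have hs : Finsupp.single p 1 ≤ k := by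
      rw [Finsupp.single_le_iff]
      omega
    obtain ⟨j, hj⟩ := exists_derivTensor_ne_zero D (pderiv p h) (k - Finsupp.single p 1)
      (by
        have : ∑ q, (k - Finsupp.single p 1 : Fin P →₀ ℕ) q + ∑ q, Finsupp.single p 1 q
            = ∑ q, k q := by
          rw [← Finset.sum_add_distrib]
          refine Finset.sum_congr rfl fun q _ => ?_
          rw [← Finsupp.add_apply, tsub_add_cancel_of_le hs]
        simp only [hk, Finsupp.single_apply, Finset.sum_ite_eq, Finset.mem_univ, if_true] at this
        omega)
      (by
        rw [coeff_pderiv, tsub_add_cancel_of_le hs]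
        exact mul_ne_zero hc (by positivity))
    exact ⟨Fin.cons p j, by simpa only [derivTensor, Fin.cons_zero, Fin.tail_cons] using hj⟩

end Tensor

/-! ### Leading coefficients of Hermite expansions -/

section HermitePolynomial

open MvPolynomial

variable {P : ℕ}

theorem coeff_prod_aeval_X (f : Fin P → Polynomial ℤ) (m : Fin P →₀ ℕ) :
    coeff m (∏ p, Polynomial.aeval (X p : MvPolynomial (Fin P) ℝ) (f p))
      = ∏ p, ((f p).coeff (m p) : ℝ) := by
  have h1 : ∀ p, Polynomial.aeval (X p : MvPolynomial (Fin P) ℝ) (f p)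
      = ∑ l ∈ Finset.range ((f p).natDegree + 1), ((f p).coeff l : ℝ) • X p ^ l := by
    intro p
    rw [Polynomial.aeval_eq_sum_range]
    simp [Int.cast_smul_eq_zsmul]
  simp only [h1]
  rw [Finset.prod_univ_sum, coeff_sum]
  have h2 : ∀ l : Fin P → ℕ, coeff m (∏ p, ((f p).coeff (l p) : ℝ) • X p ^ l p)
      = if l = m then ∏ p, ((f p).coeff (l p) : ℝ) else 0 := by
    intro l
    have : (∏ p, ((f p).coeff (l p) : ℝ) • X p ^ l p : MvPolynomial (Fin P) ℝ)
        = monomial (Finsupp.equivFunOnFinite.symm l) (∏ p, ((f p).coeff (l p) : ℝ)) := by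
      rw [monomial_eq, Finsupp.prod_fintype _ _ fun i => pow_zero _, map_prod,
        ← Finset.prod_mul_distrib]
      simp [smul_eq_C_mul]
    rw [this, coeff_monomial]
    congr 1
    rw [eq_iff_iff, Equiv.symm_apply_eq]
    rfl
  simp only [h2]
  rw [Finset.sum_ite_eq' _ (m : Fin P → ℕ)]
  split_ifs with hm
  · rfl
  · simp only [Fintype.mem_piFinset, Finset.mem_range, not_forall, not_lt] at hm
    obtain ⟨p, hp⟩ := hm
    rw [Finset.prod_eq_zero (Finset.mem_univ p)]
    rw [Polynomial.coeff_eq_zero_of_natDegree_lt hp, Int.cast_zero]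

/-- The polynomial with Hermite coefficients `c`. -/
noncomputable def hermitePolynomial (c : (Fin P → ℕ) →₀ ℝ) : MvPolynomial (Fin P) ℝ :=
  c.sum fun k a => a • ∏ p, Polynomial.aeval (X p) (Polynomial.hermite (k p))

theorem eval_hermitePolynomial (c : (Fin P → ℕ) →₀ ℝ) (z : Fin P → ℝ) :
    eval z (hermitePolynomial c) = hermiteSum c z := by
  have h : ∀ (p : Fin P) (f : Polynomial ℤ), eval z (Polynomial.aeval (X p) f)
      = Polynomial.aeval (z p) f := by
    intro p f
    have := Polynomial.map_aeval_eq_aeval_map (φ := RingHom.id ℤ) (ψ := eval z)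
      (Subsingleton.elim _ _) f (X p)
    simpa using this
  simp only [hermitePolynomial, hermiteSum, Finsupp.sum, map_sum, smul_eval, map_prod, h]

theorem coeff_hermitePolynomial (c : (Fin P → ℕ) →₀ ℝ) (m : Fin P →₀ ℕ) :
    coeff m (hermitePolynomial c)
      = c.sum fun k a => a * ∏ p, ((Polynomial.hermite (k p)).coeff (m p) : ℝ) := by
  simp only [hermitePolynomial, Finsupp.sum, coeff_sum, coeff_smul, coeff_prod_aeval_X,
    smul_eq_mul]

/-- Triangularity of the Hermite basis: a different exponent of at least the same total degree
exceeds `k` in some coordinate, beyond the degree of that Hermite factor. With monicity, this makes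
the top Hermite coefficients equal to the top monomial coefficients. -/
theorem prod_coeff_hermite_eq_zero {k : Fin P → ℕ} {m : Fin P →₀ ℕ} (hk : ∑ p, k p ≤ ∑ p, m p)
    (hne : k ≠ m) : ∏ p, ((Polynomial.hermite (k p)).coeff (m p) : ℝ) = 0 := by
  obtain ⟨p, hp⟩ : ∃ p, k p < m p := by
    by_contra! h
    exact hne (funext fun p => ((Finset.sum_eq_sum_iff_of_le fun p _ => h p).1
      (le_antisymm (Finset.sum_le_sum fun p _ => h p) hk) p (Finset.mem_univ p)).symm)
  rw [Finset.prod_eq_zero (Finset.mem_univ p)]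
  rw [Polynomial.coeff_hermite_of_lt hp, Int.cast_zero]

theorem coeff_hermitePolynomial_of_lt (c : (Fin P → ℕ) →₀ ℝ) (m : Fin P →₀ ℕ)
    (hm : hermiteDegree c < ∑ p, m p) : coeff m (hermitePolynomial c) = 0 := by
  rw [coeff_hermitePolynomial]
  refine Finset.sum_eq_zero fun k hk => ?_
  have hk' : ∑ p, k p ≤ hermiteDegree c :=
    Finset.le_sup (f := fun k : Fin P → ℕ => ∑ p, k p) hk
  beta_reduce
  rw [prod_coeff_hermite_eq_zero (by omega), mul_zero]
  rintro rfl
  omega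

theorem coeff_hermitePolynomial_of_eq (c : (Fin P → ℕ) →₀ ℝ) (m : Fin P →₀ ℕ)
    (hm : ∑ p, m p = hermiteDegree c) : coeff m (hermitePolynomial c) = c m := by
  rw [coeff_hermitePolynomial, Finsupp.sum, Finset.sum_eq_single (m : Fin P → ℕ)]
  · simp
  · intro k hk hne
    have hk' : ∑ p, k p ≤ hermiteDegree c :=
      Finset.le_sup (f := fun k : Fin P → ℕ => ∑ p, k p) hk
    rw [prod_coeff_hermite_eq_zero (by omega) hne, mul_zero]
  · intro h
    rw [Finsupp.notMem_support_iff.1 h, zero_mul]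

theorem exists_coeff_hermitePolynomial_ne_zero {c : (Fin P → ℕ) →₀ ℝ} (hc : c ≠ 0) :
    ∃ m : Fin P →₀ ℕ, ∑ p, m p = hermiteDegree c ∧ coeff m (hermitePolynomial c) ≠ 0 := by
  obtain ⟨k, hk, hk'⟩ := Finset.exists_mem_eq_sup c.support (Finsupp.support_nonempty_iff.2 hc)
    fun k : Fin P → ℕ => ∑ p, k p
  refine ⟨Finsupp.equivFunOnFinite.symm k, hk'.symm, ?_⟩
  rw [coeff_hermitePolynomial_of_eq c _ hk'.symm]
  exact Finsupp.mem_support_iff.1 hk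

/-- The leading tensor of the polynomial with Hermite coefficients `c`. -/
noncomputable def leadingTensor (c : (Fin P → ℕ) →₀ ℝ) (j : Fin (hermiteDegree c) → Fin P) : ℝ :=
  derivTensor (hermiteDegree c) (hermitePolynomial c) j

theorem exists_leadingTensor_ne_zero {c : (Fin P → ℕ) →₀ ℝ} (hc : c ≠ 0) :
    ∃ j, leadingTensor c j ≠ 0 := by
  obtain ⟨m, hm, hm'⟩ := exists_coeff_hermitePolynomial_ne_zero hc
  exact exists_derivTensor_ne_zero _ _ m hm hm'

variable {d : ℕ}

theorem target_eq_eval (c : (Fin P → ℕ) →₀ ℝ) (M : Matrix (Fin P) (Fin d) ℝ) (x : Fin d → ℝ) :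
    target c M x = eval x (compMatrix M (hermitePolynomial c)) := by
  rw [eval_compMatrix, eval_hermitePolynomial, target]

theorem memLp_target (c : (Fin P → ℕ) →₀ ℝ) (M : Matrix (Fin P) (Fin d) ℝ) :
    MemLp (target c M) 2 (gaussian d) := by
  rw [show target c M = _ from funext (target_eq_eval c M)]
  exact memLp_eval_gaussian _

theorem integral_target_mul_prod (c : (Fin P → ℕ) →₀ ℝ) (M : Matrix (Fin P) (Fin d) ℝ)
    {i : Fin (hermiteDegree c) → Fin d} (hi : Function.Injective i) :
    ∫ x, target c M x * ∏ k, x (i k) ∂(gaussian d)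
      = ∑ j, leadingTensor c j * ∏ k, M (j k) (i k) := by
  simp only [target, ← eval_hermitePolynomial]
  exact integral_eval_mulVec_mul_prod M _ _ (coeff_hermitePolynomial_of_lt c) i hi

end HermitePolynomial

/-! ### Symmetries and fourth moments of the uniform semi-orthogonal matrix -/

section Uniform

variable {P d : ℕ} (hPd : P ≤ d)

theorem continuous_firstRows : Continuous fun Q : Matrix.orthogonalGroup (Fin d) ℝ =>
    Q.1.submatrix (Fin.castLE hPd) (id : Fin d → Fin d) :=
  continuous_subtype_val.matrix_submatrix _ _

instance instIsProbabilityMeasureHaarTop : IsProbabilityMeasure (Measure.haarMeasure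
    (⊤ : TopologicalSpace.PositiveCompacts (Matrix.orthogonalGroup (Fin d) ℝ))) :=
  ⟨Measure.haarMeasure_self⟩

instance instIsProbabilityMeasureUniformSemiOrthogonal :
    IsProbabilityMeasure (uniformSemiOrthogonal hPd) :=
  Measure.isProbabilityMeasure_map (continuous_firstRows hPd).measurable.aemeasurable

theorem ae_mul_transpose_eq_one :
    ∀ᵐ M ∂(uniformSemiOrthogonal hPd), M * M.transpose = 1 := by
  have hc : Continuous fun M : Matrix (Fin P) (Fin d) ℝ => M * M.transpose := by fun_prop
  refine (ae_map_iff (continuous_firstRows hPd).measurable.aemeasurable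
    (isClosed_eq hc continuous_const).measurableSet).2 (Filter.Eventually.of_forall fun Q => ?_)
  have hQ := (Matrix.mem_orthogonalGroup_iff (Fin d) ℝ).1 Q.2
  ext a b
  have := congrFun (congrFun hQ (Fin.castLE hPd a)) (Fin.castLE hPd b)
  simpa [Matrix.mul_apply, Matrix.one_apply, Matrix.star_apply] using this

/-- A right translate of the left Haar measure is again a left Haar probability measure, hence the
same one by uniqueness. Right invariance is what is needed, since it acts on the columns of the
first `P` rows. -/
theorem map_mul_right_haarMeasure (R : Matrix.orthogonalGroup (Fin d) ℝ) :
    (Measure.haarMeasure (⊤ : TopologicalSpace.PositiveCompacts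
      (Matrix.orthogonalGroup (Fin d) ℝ))).map (· * R) = Measure.haarMeasure ⊤ := by
  have : IsProbabilityMeasure ((Measure.haarMeasure (⊤ : TopologicalSpace.PositiveCompacts
      (Matrix.orthogonalGroup (Fin d) ℝ))).map (· * R)) :=
    Measure.isProbabilityMeasure_map (by fun_prop)
  exact Measure.isHaarMeasure_eq_of_isProbabilityMeasure _ _

theorem integrable_uniformSemiOrthogonal {F : Matrix (Fin P) (Fin d) ℝ → ℝ} (hF : Continuous F) :
    Integrable F (uniformSemiOrthogonal hPd) := by
  refine (integrable_map_measure hF.aestronglyMeasurable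
    (continuous_firstRows hPd).measurable.aemeasurable).2 ?_
  exact (hF.comp (continuous_firstRows hPd)).integrable_of_hasCompactSupport
    (HasCompactSupport.of_compactSpace _)

theorem integral_mul_right_uniformSemiOrthogonal {F : Matrix (Fin P) (Fin d) ℝ → ℝ}
    (hF : Continuous F) {R : Matrix (Fin d) (Fin d) ℝ} (hR : R ∈ Matrix.orthogonalGroup (Fin d) ℝ) :
    ∫ M, F (M * R) ∂(uniformSemiOrthogonal hPd) = ∫ M, F M ∂(uniformSemiOrthogonal hPd) := by
  have hm := (continuous_firstRows hPd).measurable.aemeasurable (μ := Measure.haarMeasure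
    (⊤ : TopologicalSpace.PositiveCompacts (Matrix.orthogonalGroup (Fin d) ℝ)))
  have hF' : Continuous fun M : Matrix (Fin P) (Fin d) ℝ => F (M * R) :=
    hF.comp (by fun_prop)
  rw [uniformSemiOrthogonal, integral_map hm hF'.aestronglyMeasurable,
    integral_map hm hF.aestronglyMeasurable]
  conv_rhs => rw [← map_mul_right_haarMeasure (⟨R, hR⟩ : Matrix.orthogonalGroup (Fin d) ℝ)]
  have h := integral_map (μ := Measure.haarMeasure (⊤ : TopologicalSpace.PositiveCompacts
      (Matrix.orthogonalGroup (Fin d) ℝ)))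
    (measurable_mul_const (⟨R, hR⟩ : Matrix.orthogonalGroup (Fin d) ℝ)).aemeasurable
    (hF.comp (continuous_firstRows hPd)).aestronglyMeasurable
  exact h.symm

/-- Invariance under permutations of the columns. -/
theorem integral_perm_uniformSemiOrthogonal {F : Matrix (Fin P) (Fin d) ℝ → ℝ}
    (hF : Continuous F) (π : Equiv.Perm (Fin d)) :
    ∫ M, F (fun p s => M p (π s)) ∂(uniformSemiOrthogonal hPd)
      = ∫ M, F M ∂(uniformSemiOrthogonal hPd) := by
  have hR : (1 : Matrix (Fin d) (Fin d) ℝ).submatrix id π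
      ∈ Matrix.orthogonalGroup (Fin d) ℝ := by
    rw [Matrix.mem_orthogonalGroup_iff, Matrix.transpose_submatrix, Matrix.transpose_one,
      Matrix.submatrix_mul_equiv, one_mul, Matrix.submatrix_id_id]
  rw [← integral_mul_right_uniformSemiOrthogonal hPd hF hR]
  congr 1
  ext M
  congr 1
  ext p s
  simp [Matrix.mul_apply, Matrix.one_apply]

/-- Invariance under sign changes of the columns. -/
theorem integral_sign_uniformSemiOrthogonal {F : Matrix (Fin P) (Fin d) ℝ → ℝ}
    (hF : Continuous F) (s₀ : Fin d) :
    ∫ M, F (fun p s => if s = s₀ then - M p s else M p s) ∂(uniformSemiOrthogonal hPd)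
      = ∫ M, F M ∂(uniformSemiOrthogonal hPd) := by
  have hR : Matrix.diagonal (fun s => if s = s₀ then (-1 : ℝ) else 1)
      ∈ Matrix.orthogonalGroup (Fin d) ℝ := by
    rw [Matrix.mem_orthogonalGroup_iff, Matrix.diagonal_transpose,
      Matrix.diagonal_mul_diagonal, ← Matrix.diagonal_one]
    congr 1
    ext s
    by_cases hs : s = s₀ <;> simp [hs]
  rw [← integral_mul_right_uniformSemiOrthogonal hPd hF hR]
  congr 1
  ext M
  congr 1
  ext p s
  rw [Matrix.mul_diagonal]
  split_ifs <;> ring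

/-- The reflection `(u, v) ↦ ((3 u + 4 v) / 5, (4 u - 3 v) / 5)` of two coordinates. -/
theorem integral_reflection_uniformSemiOrthogonal {F : ℝ → ℝ → ℝ}
    (hF : Continuous fun q : ℝ × ℝ => F q.1 q.2) (p : Fin P) {a b : Fin d} (hab : a ≠ b) :
    ∫ M, F ((3 * M p a + 4 * M p b) / 5) ((4 * M p a - 3 * M p b) / 5)
        ∂(uniformSemiOrthogonal hPd)
      = ∫ M, F (M p a) (M p b) ∂(uniformSemiOrthogonal hPd) := by
  -- The Householder reflection of `w = e_a - 2 e_b`, with `|w|² = 5`, has the rational entries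
  -- `3/5`, `4/5`, `-3/5` on the two coordinates.
  set w : Fin d → ℝ := Pi.single a 1 - Pi.single b 2 with hw
  have hww : w ⬝ᵥ w = 5 := by
    simp [hw, dotProduct_sub, hab]
    norm_num
  set R : Matrix (Fin d) (Fin d) ℝ := 1 - (2 / 5 : ℝ) • Matrix.vecMulVec w w with hRdef
  have hR : R ∈ Matrix.orthogonalGroup (Fin d) ℝ := by
    rw [Matrix.mem_orthogonalGroup_iff]
    have hT : R.transpose = R := by
      ext i j
      simp [hRdef, Matrix.vecMulVec_apply, Matrix.one_apply, mul_comm, eq_comm]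
    have hV : Matrix.vecMulVec w w * Matrix.vecMulVec w w = (5 : ℝ) • Matrix.vecMulVec w w := by
      rw [Matrix.vecMulVec_mul_vecMulVec, hww, Matrix.vecMulVec_smul]
    rw [hT, hRdef, sub_mul, mul_sub, mul_sub, smul_mul_smul_comm, hV]
    simp only [one_mul, mul_one, smul_smul]
    ext i j
    simp
    ring
  have hG : Continuous fun M : Matrix (Fin P) (Fin d) ℝ => F (M p a) (M p b) :=
    hF.comp (f := fun M : Matrix (Fin P) (Fin d) ℝ => (M p a, M p b)) (by fun_prop)
  rw [← integral_mul_right_uniformSemiOrthogonal hPd hG hR]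
  have hMR : ∀ (M : Matrix (Fin P) (Fin d) ℝ) s,
      (M * R) p s = M p s - 2 / 5 * (M p a - 2 * M p b) * w s := by
    intro M s
    have : (M * Matrix.vecMulVec w w) p s = (M p a - 2 * M p b) * w s := by
      rw [Matrix.mul_vecMulVec, Matrix.vecMulVec_apply]
      congr 1
      simp [hw, Matrix.mulVec_sub, mul_comm]
    rw [hRdef, Matrix.mul_sub, Matrix.mul_one, Matrix.mul_smul, Matrix.sub_apply, Matrix.smul_apply, this,
      smul_eq_mul]
    ring
  congr 1
  ext M
  rw [hMR, hMR]
  congr 1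
  · simp [hw, hab]
    ring
  · simp [hw, hab.symm]
    ring

/-- Compare `u ^ 4 + v ^ 4` before and after the reflection. The terms in `u ^ 3 * v` and `u * v ^
3` have opposite coefficients and cancel by the swap symmetry; what remains is `576 E u⁴ = 1728 E
u²v²`. -/
theorem integral_pow_four_eq (p : Fin P) {a b : Fin d} (hab : a ≠ b) :
    ∫ M, M p a ^ 4 ∂(uniformSemiOrthogonal hPd)
      = 3 * ∫ M, M p a ^ 2 * M p b ^ 2 ∂(uniformSemiOrthogonal hPd) := by
  have hswap : ∀ k l : ℕ, ∫ M, M p a ^ k * M p b ^ l ∂(uniformSemiOrthogonal hPd)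
      = ∫ M, M p b ^ k * M p a ^ l ∂(uniformSemiOrthogonal hPd) := by
    intro k l
    have := integral_perm_uniformSemiOrthogonal hPd
      (F := fun M => M p b ^ k * M p a ^ l) (by fun_prop) (Equiv.swap a b)
    simpa using this
  have hint : ∀ k l : ℕ, Integrable (fun M : Matrix (Fin P) (Fin d) ℝ => M p a ^ k * M p b ^ l)
      (uniformSemiOrthogonal hPd) := fun k l => integrable_uniformSemiOrthogonal hPd (by fun_prop)
  have h40 := hswap 4 0
  have h31 := hswap 3 1
  have hrefl := integral_reflection_uniformSemiOrthogonal hPd (F := fun u v => u ^ 4 + v ^ 4)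
    (by fun_prop) p hab
  have hexp : ∀ M : Matrix (Fin P) (Fin d) ℝ,
      ((3 * M p a + 4 * M p b) / 5) ^ 4 + ((4 * M p a - 3 * M p b) / 5) ^ 4
      = 337 / 625 * (M p a ^ 4 * M p b ^ 0) + 337 / 625 * (M p a ^ 0 * M p b ^ 4)
        + 1728 / 625 * (M p a ^ 2 * M p b ^ 2)
        - 336 / 625 * (M p a ^ 3 * M p b ^ 1) + 336 / 625 * (M p a ^ 1 * M p b ^ 3) := by
    intro M
    ring
  have hexp' : ∀ M : Matrix (Fin P) (Fin d) ℝ, M p a ^ 4 + M p b ^ 4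
      = M p a ^ 4 * M p b ^ 0 + M p a ^ 0 * M p b ^ 4 := by
    intro M
    ring
  simp only [hexp, hexp'] at hrefl
  rw [integral_add, integral_sub, integral_add, integral_add, integral_add] at hrefl
  · simp only [integral_const_mul] at hrefl
    have e1 : ∀ k l : ℕ, ∫ M, M p b ^ k * M p a ^ l ∂(uniformSemiOrthogonal hPd)
        = ∫ M, M p a ^ l * M p b ^ k ∂(uniformSemiOrthogonal hPd) := fun k l => by
      simp only [mul_comm]
    rw [e1] at h40 h31
    have e2 : ∫ M, M p a ^ 4 ∂(uniformSemiOrthogonal hPd)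
        = ∫ M, M p a ^ 4 * M p b ^ 0 ∂(uniformSemiOrthogonal hPd) := by simp
    rw [e2]
    linarith
  all_goals first
    | exact hint _ _
    | exact (hint _ _).const_mul _
    | exact ((hint _ _).const_mul _).add ((hint _ _).const_mul _)
    | exact (((hint _ _).const_mul _).add ((hint _ _).const_mul _)).add ((hint _ _).const_mul _)
    | exact ((((hint _ _).const_mul _).add ((hint _ _).const_mul _)).add
        ((hint _ _).const_mul _)).sub ((hint _ _).const_mul _)

theorem sum_sq_row {M : Matrix (Fin P) (Fin d) ℝ} (hM : M * M.transpose = 1) (p : Fin P) :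
    ∑ s, M p s ^ 2 = 1 := by
  have := congrFun (congrFun hM p) p
  simpa [Matrix.mul_apply, sq] using this

/-- Each fourth moment is three times a mixed moment with any other column. Summing over ordered
pairs of distinct columns gives at most `3 E (∑ s, M p s ^ 2) ^ 2 = 3`, as rows are unit vectors. -/
theorem mul_integral_sum_pow_four_le (p : Fin P) :
    ((d : ℝ) - 1) * ∫ M, ∑ s, M p s ^ 4 ∂(uniformSemiOrthogonal hPd) ≤ 3 := by
  have h1 : ∀ s t : Fin d, t ≠ s → ∫ M, M p s ^ 4 ∂(uniformSemiOrthogonal hPd)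
      = 3 * ∫ M, M p s ^ 2 * M p t ^ 2 ∂(uniformSemiOrthogonal hPd) :=
    fun s t h => integral_pow_four_eq hPd p h.symm
  have h2 : ∀ s : Fin d, ((d : ℝ) - 1) * ∫ M, M p s ^ 4 ∂(uniformSemiOrthogonal hPd)
      = 3 * ∑ t ∈ Finset.univ.erase s,
        ∫ M, M p s ^ 2 * M p t ^ 2 ∂(uniformSemiOrthogonal hPd) := by
    intro s
    rw [Finset.mul_sum, ← Finset.sum_congr rfl fun t ht => h1 s t (Finset.ne_of_mem_erase ht),
      Finset.sum_const, nsmul_eq_mul, Finset.card_erase_of_mem (Finset.mem_univ s),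
      Finset.card_univ, Fintype.card_fin, Nat.cast_sub (Fin.pos s)]
    simp
  have hint : ∀ s t, Integrable (fun M : Matrix (Fin P) (Fin d) ℝ => M p s ^ 2 * M p t ^ 2)
      (uniformSemiOrthogonal hPd) := fun s t => integrable_uniformSemiOrthogonal hPd (by fun_prop)
  rw [integral_finsetSum _ fun s _ => integrable_uniformSemiOrthogonal hPd (by fun_prop),
    Finset.mul_sum]
  simp only [h2]
  rw [← Finset.mul_sum]
  have h3 : ∑ s, ∑ t ∈ Finset.univ.erase s,
      ∫ M, M p s ^ 2 * M p t ^ 2 ∂(uniformSemiOrthogonal hPd) ≤ 1 := by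
    calc _ ≤ ∑ s, ∑ t, ∫ M, M p s ^ 2 * M p t ^ 2 ∂(uniformSemiOrthogonal hPd) :=
          Finset.sum_le_sum fun s _ => Finset.sum_le_sum_of_subset_of_nonneg
            (Finset.erase_subset _ _) fun t _ _ => integral_nonneg fun M => by positivity
      _ = ∫ M, ∑ s, ∑ t, M p s ^ 2 * M p t ^ 2 ∂(uniformSemiOrthogonal hPd) := by
          rw [integral_finsetSum _ fun s _ => integrable_finsetSum _ fun t _ => hint s t]
          exact Finset.sum_congr rfl fun s _ => (integral_finsetSum _ fun t _ => hint s t).symm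
      _ = ∫ M, (1 : ℝ) ∂(uniformSemiOrthogonal hPd) := by
          refine integral_congr_ae ?_
          filter_upwards [ae_mul_transpose_eq_one hPd] with M hM
          simp only [← Finset.mul_sum, sum_sq_row hM, mul_one]
      _ ≤ 1 := by simp
  linarith

end Uniform

/-! ### Second moments of the contracted tensor -/

section Contraction

variable {P D d : ℕ}

/-- The entry `i` of the tensor `B` contracted with `D` copies of the matrix `M`. -/
noncomputable def contraction (B : (Fin D → Fin P) → ℝ) (M : Matrix (Fin P) (Fin d) ℝ)
    (i : Fin D → Fin d) : ℝ :=
  ∑ j, B j * ∏ k, M (j k) (i k)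

theorem continuous_contraction (B : (Fin D → Fin P) → ℝ) (i : Fin D → Fin d) :
    Continuous fun M : Matrix (Fin P) (Fin d) ℝ => contraction B M i := by
  unfold contraction
  fun_prop

theorem sum_prod_apply (f : Fin D → Fin d → ℝ) :
    ∑ i : Fin D → Fin d, ∏ k, f k (i k) = ∏ k, ∑ s, f k s := by
  rw [Finset.prod_univ_sum, Fintype.piFinset_univ]

/-- The rows of `M` are orthonormal, so the `D`-fold tensor power of its transpose is an isometry.
-/
theorem sum_contraction_sq (B : (Fin D → Fin P) → ℝ) {M : Matrix (Fin P) (Fin d) ℝ}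
    (hM : M * M.transpose = 1) : ∑ i, contraction B M i ^ 2 = ∑ j, B j ^ 2 := by
  have hrow : ∀ p q : Fin P, ∑ s, M p s * M q s = if p = q then 1 else 0 := by
    intro p q
    have := congrFun (congrFun hM p) q
    simpa [Matrix.mul_apply, Matrix.one_apply] using this
  have h1 : ∀ i, contraction B M i ^ 2
      = ∑ j, ∑ j', B j * B j' * ∏ k, M (j k) (i k) * M (j' k) (i k) := by
    intro i
    rw [contraction, sq, Finset.sum_mul_sum]
    refine Finset.sum_congr rfl fun j _ => Finset.sum_congr rfl fun j' _ => ?_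
    rw [Finset.prod_mul_distrib]
    ring
  simp only [h1]
  rw [Finset.sum_comm]
  refine Finset.sum_congr rfl fun j _ => ?_
  rw [Finset.sum_comm, Finset.sum_eq_single j]
  · rw [← Finset.mul_sum, sum_prod_apply fun k s => M (j k) s * M (j k) s]
    simp [hrow, sq]
  · intro j' _ hj'
    obtain ⟨k, hk⟩ := Function.ne_iff.1 hj'
    rw [← Finset.mul_sum, sum_prod_apply fun k s => M (j k) s * M (j' k) s,
      Finset.prod_eq_zero (Finset.mem_univ k), mul_zero]
    rw [hrow, if_neg hk.symm]
  · simp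

/-- Split according to the common value `s` of `i a` and `i b`; the other indices are then free and
each contributes a factor `1`. -/
theorem sum_ite_prod (w : Fin D → Fin d → ℝ) (hw : ∀ k, ∑ s, w k s = 1) {a b : Fin D}
    (hab : a ≠ b) :
    ∑ i : Fin D → Fin d, (if i a = i b then ∏ k, w k (i k) else 0) = ∑ s, w a s * w b s := by
  have h1 : ∀ i : Fin D → Fin d, (if i a = i b then ∏ k, w k (i k) else 0)
      = ∑ s, ∏ k, (if k = a ∨ k = b then (if i k = s then w k (i k) else 0) else w k (i k)) := by
    intro i
    split_ifs with h
    · rw [Finset.sum_eq_single (i a)]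
      · refine Finset.prod_congr rfl fun k _ => ?_
        split_ifs with h1 h2
        · rfl
        · rcases h1 with rfl | rfl
          · exact absurd rfl h2
          · exact absurd h.symm h2
        · rfl
      · intro s _ hs
        rw [Finset.prod_eq_zero (Finset.mem_univ a)]
        rw [if_pos (Or.inl rfl), if_neg hs.symm]
      · simp
    · refine (Finset.sum_eq_zero fun s _ => ?_).symm
      by_cases hs : i a = s
      · rw [Finset.prod_eq_zero (Finset.mem_univ b)]
        rw [if_pos (Or.inr rfl), if_neg fun hb => h (hs.trans hb.symm)]
      · rw [Finset.prod_eq_zero (Finset.mem_univ a)]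
        rw [if_pos (Or.inl rfl), if_neg hs]
  simp only [h1]
  rw [Finset.sum_comm]
  refine Finset.sum_congr rfl fun s _ => ?_
  rw [sum_prod_apply fun k t => if k = a ∨ k = b then (if t = s then w k t else 0) else w k t,
    Finset.prod_eq_mul a b hab]
  · simp
  · rintro k - ⟨ha, hb⟩
    simp [ha, hb, hw]
  · simp
  · simp

theorem contraction_sq_le (B : (Fin D → Fin P) → ℝ) (M : Matrix (Fin P) (Fin d) ℝ)
    (i : Fin D → Fin d) :
    contraction B M i ^ 2 ≤ (∑ j, B j ^ 2) * ∑ j : Fin D → Fin P, ∏ k, M (j k) (i k) ^ 2 := by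
  refine (Finset.sum_mul_sq_le_sq_mul_sq _ _ _).trans_eq ?_
  simp only [Finset.prod_pow]

/-- Cauchy–Schwarz decouples `B` from `M`, a union bound runs over the pairs of positions that may
collide, and `2 x² y² ≤ x⁴ + y⁴` reduces each collision sum to fourth powers of single rows. -/
theorem sum_contraction_sq_not_injective_le (B : (Fin D → Fin P) → ℝ)
    {M : Matrix (Fin P) (Fin d) ℝ} (hM : M * M.transpose = 1) :
    ∑ i with ¬Function.Injective i, contraction B M i ^ 2
      ≤ (∑ j, B j ^ 2) * ∑ q : Fin D × Fin D, ∑ j : Fin D → Fin P,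
        ∑ s, (M (j q.1) s ^ 4 + M (j q.2) s ^ 4) / 2 := by
  have h1 : ∀ i : Fin D → Fin d, ¬Function.Injective i →
      contraction B M i ^ 2 ≤ (∑ j, B j ^ 2) * ∑ q : Fin D × Fin D with q.1 ≠ q.2,
        ∑ j : Fin D → Fin P, if i q.1 = i q.2 then ∏ k, M (j k) (i k) ^ 2 else 0 := by
    intro i hi
    refine (contraction_sq_le B M i).trans ?_
    refine mul_le_mul_of_nonneg_left ?_ (Finset.sum_nonneg fun j _ => sq_nonneg _)
    simp only [Function.Injective, not_forall] at hi
    obtain ⟨a, b, hab, hne⟩ := hi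
    refine le_trans (le_of_eq ?_) (Finset.single_le_sum (fun q _ => ?_)
      (Finset.mem_filter.2 ⟨Finset.mem_univ (a, b), hne⟩))
    · simp [hab]
    · refine Finset.sum_nonneg fun j _ => ?_
      split_ifs
      · exact Finset.prod_nonneg fun k _ => sq_nonneg _
      · rfl
  calc _ ≤ ∑ i : Fin D → Fin d with ¬Function.Injective i,
        (∑ j, B j ^ 2) * ∑ q : Fin D × Fin D with q.1 ≠ q.2,
          ∑ j : Fin D → Fin P, (if i q.1 = i q.2 then ∏ k, M (j k) (i k) ^ 2 else 0) :=
        Finset.sum_le_sum fun i hi => h1 i (Finset.mem_filter.1 hi).2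
    _ ≤ ∑ i : Fin D → Fin d,
        (∑ j, B j ^ 2) * ∑ q : Fin D × Fin D with q.1 ≠ q.2,
          ∑ j : Fin D → Fin P, (if i q.1 = i q.2 then ∏ k, M (j k) (i k) ^ 2 else 0) := by
        refine Finset.sum_le_sum_of_subset_of_nonneg (Finset.filter_subset _ _) fun i _ _ => ?_
        refine mul_nonneg (Finset.sum_nonneg fun j _ => sq_nonneg _)
          (Finset.sum_nonneg fun q _ => Finset.sum_nonneg fun j _ => ?_)
        split_ifs
        · exact Finset.prod_nonneg fun k _ => sq_nonneg _
        · rfl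
    _ = (∑ j, B j ^ 2) * ∑ q : Fin D × Fin D with q.1 ≠ q.2, ∑ j : Fin D → Fin P,
        ∑ s, M (j q.1) s ^ 2 * M (j q.2) s ^ 2 := by
        rw [← Finset.mul_sum, Finset.sum_comm]
        congr 1
        refine Finset.sum_congr rfl fun q hq => ?_
        rw [Finset.sum_comm]
        refine Finset.sum_congr rfl fun j _ => ?_
        exact sum_ite_prod (fun k s => M (j k) s ^ 2) (fun k => sum_sq_row hM (j k))
          (Finset.mem_filter.1 hq).2
    _ ≤ (∑ j, B j ^ 2) * ∑ q : Fin D × Fin D with q.1 ≠ q.2, ∑ j : Fin D → Fin P,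
        ∑ s, (M (j q.1) s ^ 4 + M (j q.2) s ^ 4) / 2 := by
        refine mul_le_mul_of_nonneg_left ?_ (Finset.sum_nonneg fun j _ => sq_nonneg _)
        refine Finset.sum_le_sum fun q _ => Finset.sum_le_sum fun j _ =>
          Finset.sum_le_sum fun s _ => ?_
        nlinarith [sq_nonneg (M (j q.1) s ^ 2 - M (j q.2) s ^ 2)]
    _ ≤ _ := by
        refine mul_le_mul_of_nonneg_left ?_ (Finset.sum_nonneg fun j _ => sq_nonneg _)
        refine Finset.sum_le_sum_of_subset_of_nonneg (Finset.filter_subset _ _) fun q _ _ => ?_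
        exact Finset.sum_nonneg fun j _ => Finset.sum_nonneg fun s _ => by positivity

variable (hPd : P ≤ d)

theorem mul_integral_sum_not_injective_le (hd : 1 ≤ d) (B : (Fin D → Fin P) → ℝ) :
    ((d : ℝ) - 1) * ∫ M : Matrix (Fin P) (Fin d) ℝ, ∑ i with ¬Function.Injective i,
        contraction B M i ^ 2 ∂(uniformSemiOrthogonal hPd)
      ≤ (∑ j, B j ^ 2) * (D ^ 2 * P ^ D * 3) := by
  have hd' : (0 : ℝ) ≤ (d : ℝ) - 1 := by
    rw [sub_nonneg]
    exact_mod_cast hd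
  have hint : ∀ p : Fin P, Integrable (fun M : Matrix (Fin P) (Fin d) ℝ => ∑ s, M p s ^ 4)
      (uniformSemiOrthogonal hPd) := fun p => integrable_uniformSemiOrthogonal hPd (by fun_prop)
  have hint' : ∀ p q : Fin P, Integrable (fun M : Matrix (Fin P) (Fin d) ℝ =>
      ((∑ s, M p s ^ 4) + ∑ s, M q s ^ 4) / 2) (uniformSemiOrthogonal hPd) :=
    fun p q => integrable_uniformSemiOrthogonal hPd (by fun_prop)
  have hle : ∫ M : Matrix (Fin P) (Fin d) ℝ, ∑ i with ¬Function.Injective i,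
        contraction B M i ^ 2 ∂(uniformSemiOrthogonal hPd)
      ≤ ∫ M, (∑ j, B j ^ 2) * ∑ q : Fin D × Fin D, ∑ j : Fin D → Fin P,
        ((∑ s, M (j q.1) s ^ 4) + ∑ s, M (j q.2) s ^ 4) / 2 ∂(uniformSemiOrthogonal hPd) := by
    refine integral_mono_ae (integrable_uniformSemiOrthogonal hPd ?_)
      (integrable_uniformSemiOrthogonal hPd (by fun_prop)) ?_
    · exact continuous_finsetSum _ fun i _ => (continuous_contraction B i).pow 2
    · filter_upwards [ae_mul_transpose_eq_one hPd] with M hM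
      refine (sum_contraction_sq_not_injective_le B hM).trans_eq ?_
      simp only [← Finset.sum_div, Finset.sum_add_distrib]
  rw [integral_const_mul, integral_finsetSum _ fun q _ => integrable_finsetSum _ fun j _ =>
    hint' _ _] at hle
  refine (mul_le_mul_of_nonneg_left hle hd').trans ?_
  rw [mul_left_comm, Finset.mul_sum]
  refine mul_le_mul_of_nonneg_left ?_ (Finset.sum_nonneg fun j _ => sq_nonneg _)
  have hq : ∀ q : Fin D × Fin D, ((d : ℝ) - 1) * ∫ M, ∑ j : Fin D → Fin P,
      ((∑ s, M (j q.1) s ^ 4) + ∑ s, M (j q.2) s ^ 4) / 2 ∂(uniformSemiOrthogonal hPd)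
      ≤ P ^ D * 3 := by
    intro q
    rw [integral_finsetSum _ fun j _ => hint' _ _, Finset.mul_sum]
    refine (Finset.sum_le_card_nsmul _ _ 3 fun j _ => ?_).trans_eq (by simp)
    rw [integral_div, integral_add (hint _) (hint _)]
    linarith [mul_integral_sum_pow_four_le hPd (j q.1), mul_integral_sum_pow_four_le hPd (j q.2)]
  refine (Finset.sum_le_card_nsmul _ _ _ fun q _ => hq q).trans_eq ?_
  simp
  ring

theorem integral_contraction_sq_eq (B : (Fin D → Fin P) → ℝ) {i i' : Fin D → Fin d}
    (hi : Function.Injective i) (hi' : Function.Injective i') :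
    ∫ M, contraction B M i ^ 2 ∂(uniformSemiOrthogonal hPd)
      = ∫ M, contraction B M i' ^ 2 ∂(uniformSemiOrthogonal hPd) := by
  obtain ⟨π, hπ⟩ := Equiv.Perm.exists_extending_pair i' i hi' hi
  rw [← integral_perm_uniformSemiOrthogonal hPd (F := fun M => contraction B M i' ^ 2)
    ((continuous_contraction B i').pow 2) π]
  simp [contraction, ← hπ]

/-- Flip the sign of column `i k₀`: it occurs exactly once in `i` and never in `i'`, so the product
changes sign while the law of `M` does not. -/
theorem integral_contraction_mul_eq_zero (B : (Fin D → Fin P) → ℝ) {i i' : Fin D → Fin d}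
    (hi : Function.Injective i) (k₀ : Fin D) (hk₀ : ∀ k, i' k ≠ i k₀) :
    ∫ M, contraction B M i * contraction B M i' ∂(uniformSemiOrthogonal hPd) = 0 := by
  have h := integral_sign_uniformSemiOrthogonal hPd
    (F := fun M => contraction B M i * contraction B M i')
    ((continuous_contraction B i).mul (continuous_contraction B i')) (i k₀)
  have h1 : ∀ M : Matrix (Fin P) (Fin d) ℝ,
      contraction B (fun p s => if s = i k₀ then - M p s else M p s) i = - contraction B M i := by
    intro M
    unfold contraction
    rw [← Finset.sum_neg_distrib]
    refine Finset.sum_congr rfl fun j _ => ?_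
    rw [← Finset.mul_prod_erase _ _ (Finset.mem_univ k₀),
      ← Finset.mul_prod_erase _ (fun k => M (j k) (i k)) (Finset.mem_univ k₀)]
    beta_reduce
    rw [if_pos rfl, Finset.prod_congr rfl fun k hk => if_neg fun he => Finset.ne_of_mem_erase hk (hi he)]
    ring
  have h2 : ∀ M : Matrix (Fin P) (Fin d) ℝ,
      contraction B (fun p s => if s = i k₀ then - M p s else M p s) i' = contraction B M i' := by
    intro M
    simp [contraction, hk₀]
  simp only [h1, h2, neg_mul, integral_neg] at h
  linarith

/-- The total mass `b` is constant and, for large `d`, multi-indices with repetitions carry at most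
half of it. The rest is shared equally by at most `d ^ D` injective ones. -/
theorem exists_le_integral_contraction_sq (B : (Fin D → Fin P) → ℝ) (hB : ∃ j, B j ≠ 0) :
    ∃ c > (0 : ℝ), ∃ d₀ : ℕ, ∀ (d : ℕ) (hPd : P ≤ d) (i : Fin D → Fin d),
      Function.Injective i → d₀ ≤ d →
      c ≤ (d : ℝ) ^ D * ∫ M, contraction B M i ^ 2 ∂(uniformSemiOrthogonal hPd) := by
  set b := ∑ j, B j ^ 2 with hb
  have hbpos : 0 < b := by
    obtain ⟨j, hj⟩ := hB
    exact Finset.sum_pos' (fun j _ => sq_nonneg _) ⟨j, Finset.mem_univ j, by positivity⟩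
  -- The threshold gives `3 * D ^ 2 * P ^ D ≤ (d - 1) / 2`, which bounds the non-injective part by
  -- `b / 2`; the `+ 2` also ensures `d - 1 > 0`.
  refine ⟨b / 2, by positivity, D ^ 2 * P ^ D * 6 + 2, fun d hPd i hi hd => ?_⟩
  have hint : ∀ i : Fin D → Fin d, Integrable (fun M => contraction B M i ^ 2)
      (uniformSemiOrthogonal hPd) :=
    fun i => integrable_uniformSemiOrthogonal hPd ((continuous_contraction B i).pow 2)
  have hd1 : (D : ℝ) ^ 2 * P ^ D * 6 + 2 ≤ d := by exact_mod_cast hd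
  have hd2 : (0 : ℝ) < (d : ℝ) - 1 := by
    have : (0 : ℝ) ≤ (D : ℝ) ^ 2 * P ^ D * 6 := by positivity
    linarith
  have htot : ∫ M : Matrix (Fin P) (Fin d) ℝ, ∑ i with Function.Injective i, contraction B M i ^ 2
        ∂(uniformSemiOrthogonal hPd)
      + ∫ M : Matrix (Fin P) (Fin d) ℝ, ∑ i with ¬Function.Injective i, contraction B M i ^ 2
        ∂(uniformSemiOrthogonal hPd) = b := by
    rw [← integral_add (integrable_finsetSum _ fun i _ => hint i)
      (integrable_finsetSum _ fun i _ => hint i)]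
    simp only [Finset.sum_filter_add_sum_filter_not]
    rw [integral_congr_ae (g := fun _ => b)]
    · simp
    · filter_upwards [ae_mul_transpose_eq_one hPd] with M hM using sum_contraction_sq B hM
  have hnon := mul_integral_sum_not_injective_le hPd (by omega) B
  have hinj : ∫ M : Matrix (Fin P) (Fin d) ℝ, ∑ i with Function.Injective i,
        contraction B M i ^ 2 ∂(uniformSemiOrthogonal hPd)
      ≤ (d : ℝ) ^ D * ∫ M, contraction B M i ^ 2 ∂(uniformSemiOrthogonal hPd) := by
    rw [integral_finsetSum _ fun i _ => hint i,
      Finset.sum_congr rfl fun i' hi' =>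
        integral_contraction_sq_eq hPd B (Finset.mem_filter.1 hi').2 hi,
      Finset.sum_const, nsmul_eq_mul]
    refine mul_le_mul_of_nonneg_right ?_ (integral_nonneg fun M => sq_nonneg _)
    exact_mod_cast (Finset.card_filter_le _ _).trans_eq (by simp)
  rw [← hb] at hnon
  have hnon' : ∫ M : Matrix (Fin P) (Fin d) ℝ, ∑ i with ¬Function.Injective i,
      contraction B M i ^ 2 ∂(uniformSemiOrthogonal hPd) ≤ b / 2 := by
    refine le_of_mul_le_mul_left (hnon.trans ?_) hd2
    nlinarith
  linarith

end Contraction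

/-! ### Representer theorem: outputs lie in a fixed small space -/

section Representer

variable {d n : ℕ} {H : Type*} [NormedAddCommGroup H] [InnerProductSpace ℝ H]

/-- The output of a linear method lies in the span of the features of the sample points. -/
theorem IsLinearMethodOutput.mem_span {ψ : (Fin d → ℝ) → H} {L : (Fin n → ℝ × ℝ) → WithTop ℝ}
    {lam : ℝ} (hlam : 0 < lam) {x : Fin n → Fin d → ℝ} {y : Fin n → ℝ} {a : H}
    (h : IsLinearMethodOutput ψ L lam x y a) :
    a ∈ Submodule.span ℝ (Set.range fun i => ψ (x i)) := by
  set V := Submodule.span ℝ (Set.range fun i => ψ (x i)) with hV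
  have : FiniteDimensional ℝ V := FiniteDimensional.span_of_finite ℝ (Set.finite_range _)
  -- Projecting onto `V` keeps every prediction at the sample points, hence the loss, and can only
  -- reduce the norm.
  have hinner : ∀ i, inner ℝ (V.starProjection a) (ψ (x i)) = inner ℝ a (ψ (x i)) := by
    intro i
    have hi : ψ (x i) ∈ V := Submodule.subset_span ⟨i, rfl⟩
    have := V.starProjection_inner_eq_zero a _ hi
    rw [inner_sub_left] at this
    linarith
  obtain ⟨hfin, hmin⟩ := h
  have hle := hmin (V.starProjection a)
  simp only [regularizedRisk, hinner] at hle hfin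
  -- Finiteness allows the loss to be cancelled from both sides of the minimality inequality.
  have hL : L (fun i => (y i, inner ℝ a (ψ (x i)))) ≠ ⊤ := by
    intro htop
    rw [htop, WithTop.top_add] at hfin
    exact lt_irrefl _ hfin
  have hle' : lam * ‖a‖ ^ 2 ≤ lam * ‖V.starProjection a‖ ^ 2 :=
    WithTop.coe_le_coe.1 ((WithTop.add_le_add_iff_left hL).1 hle)
  have hsq := le_of_mul_le_mul_left hle' hlam
  have horth : inner ℝ (V.starProjection a) (a - V.starProjection a) = 0 := by
    rw [real_inner_comm]
    exact V.starProjection_inner_eq_zero a _ (V.starProjection_apply_mem a)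
  have hpyth := norm_add_sq_eq_norm_sq_add_norm_sq_of_inner_eq_zero _ _ horth
  rw [add_sub_cancel] at hpyth
  have hzero : a - V.starProjection a = 0 := by
    rw [← norm_eq_zero]
    nlinarith [norm_nonneg (a - V.starProjection a)]
  rw [sub_eq_zero.1 hzero]
  exact V.starProjection_apply_mem a

theorem finrank_span_range_le (v : Fin n → H) :
    Module.finrank ℝ (Submodule.span ℝ (Set.range v))
      ≤ (min (n : Cardinal) (Module.rank ℝ H)).toNat := by
  have : FiniteDimensional ℝ (Submodule.span ℝ (Set.range v)) :=
    FiniteDimensional.span_of_finite ℝ (Set.finite_range _)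
  rw [Module.finrank]
  -- The minimum is bounded by `n`, hence finite, so `toNat` does not fall to its default `0` when
  -- `H` is infinite-dimensional.
  refine Cardinal.toNat_le_toNat (le_min ?_ (Submodule.rank_le _))
    ((min_le_left _ _).trans_lt Cardinal.natCast_lt_aleph0)
  rw [← Module.finrank_eq_rank]
  exact_mod_cast (finrank_range_le_card v).trans_eq (Fintype.card_fin n)

end Representer

/-! ### Bessel's inequality for multilinear monomials -/

section Bessel

/-- Expand the nonnegative integral of `(g - p) ^ 2`, where `p` is the orthogonal projection of `g`
onto the span of the `φ s`. -/
theorem sum_sq_integral_mul_le {Ω ι : Type*} [MeasurableSpace Ω] [Fintype ι] [DecidableEq ι]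
    {μ : Measure Ω} {φ : ι → Ω → ℝ} (hφ : ∀ s, MemLp (φ s) 2 μ)
    (horth : ∀ s t, ∫ x, φ s x * φ t x ∂μ = if s = t then 1 else 0) {g : Ω → ℝ}
    (hg : MemLp g 2 μ) : ∑ s, (∫ x, g x * φ s x ∂μ) ^ 2 ≤ ∫ x, g x ^ 2 ∂μ := by
  set t : ι → ℝ := fun s => ∫ x, g x * φ s x ∂μ with ht
  have hp : MemLp (fun x => ∑ s, t s * φ s x) 2 μ :=
    memLp_finsetSum _ fun s _ => (hφ s).const_mul (t s)
  have h1 : ∫ x, g x * ∑ s, t s * φ s x ∂μ = ∑ s, t s ^ 2 := by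
    simp only [Finset.mul_sum, mul_left_comm (g _)]
    have hi : ∀ s, Integrable (fun x => t s * (g x * φ s x)) μ :=
      fun s => (hg.integrable_mul (hφ s)).const_mul (t s)
    rw [integral_finsetSum _ fun s _ => hi s]
    simp only [integral_const_mul, sq, ht]
  have h2 : ∫ x, (∑ s, t s * φ s x) ^ 2 ∂μ = ∑ s, t s ^ 2 := by
    have he : ∀ x, (∑ s, t s * φ s x) ^ 2 = ∑ s, ∑ r, t s * t r * (φ s x * φ r x) := by
      intro x
      rw [sq, Finset.sum_mul_sum]
      exact Finset.sum_congr rfl fun s _ => Finset.sum_congr rfl fun r _ =>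
        mul_mul_mul_comm _ _ _ _
    have hi : ∀ s r, Integrable (fun x => t s * t r * (φ s x * φ r x)) μ := fun s r =>
      ((hφ s).integrable_mul (hφ r)).const_mul (t s * t r)
    simp only [he]
    rw [integral_finsetSum _ fun s _ => integrable_finsetSum _ fun r _ => hi s r]
    refine Finset.sum_congr rfl fun s _ => ?_
    rw [integral_finsetSum _ fun r _ => hi s r]
    simp only [integral_const_mul, horth]
    simp [sq]
  have h3 : 0 ≤ ∫ x, (g x - ∑ s, t s * φ s x) ^ 2 ∂μ := integral_nonneg fun x => sq_nonneg _
  have h4 : ∀ x, (g x - ∑ s, t s * φ s x) ^ 2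
      = g x ^ 2 - 2 * (g x * ∑ s, t s * φ s x) + (∑ s, t s * φ s x) ^ 2 := fun x => by ring
  have hgp : Integrable (fun x => g x * ∑ s, t s * φ s x) μ := hg.integrable_mul hp
  simp only [h4] at h3
  have hsub : Integrable (fun x => g x ^ 2 - 2 * (g x * ∑ s, t s * φ s x)) μ :=
    hg.integrable_sq.sub (hgp.const_mul 2)
  rw [integral_add hsub hp.integrable_sq, integral_sub hg.integrable_sq (hgp.const_mul 2), integral_const_mul, h1, h2] at h3
  linarith

variable {d : ℕ}

theorem memLp_prod_gaussian (S : Finset (Fin d)) :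
    MemLp (fun x : Fin d → ℝ => ∏ s ∈ S, x s) 2 (gaussian d) := by
  simpa using memLp_eval_gaussian (∏ s ∈ S, MvPolynomial.X s)

theorem integral_prod_mul_prod_gaussian (S T : Finset (Fin d)) :
    ∫ x, (∏ s ∈ S, x s) * ∏ s ∈ T, x s ∂(gaussian d) = if S = T then 1 else 0 := by
  have h0 : ∫ t : ℝ, t ∂(gaussianReal 0 1) = 0 := integral_id_gaussianReal
  have h2 : ∫ t : ℝ, t * t ∂(gaussianReal 0 1) = 1 := by
    simpa [sq] using integral_pow_succ_gaussianReal 1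
  have h1 : ∀ x : Fin d → ℝ, (∏ s ∈ S, x s) * ∏ s ∈ T, x s
      = ∏ s, (if s ∈ S then x s else 1) * (if s ∈ T then x s else 1) := by
    intro x
    rw [Finset.prod_mul_distrib, Finset.prod_ite_mem, Finset.prod_ite_mem, Finset.univ_inter,
      Finset.univ_inter]
  simp only [h1]
  refine (integral_fintype_prod_eq_prod
    (fun s (t : ℝ) => (if s ∈ S then t else 1) * (if s ∈ T then t else 1))).trans ?_
  split_ifs with h
  · subst h
    refine Finset.prod_eq_one fun s _ => ?_
    by_cases hs : s ∈ S <;> simp [hs, h2]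
  · obtain ⟨s, hs⟩ : ∃ s, ¬(s ∈ S ↔ s ∈ T) := by
      by_contra! hall
      exact h (Finset.ext hall)
    refine Finset.prod_eq_zero (Finset.mem_univ s) ?_
    by_cases hS : s ∈ S <;> by_cases hT : s ∈ T <;> simp_all

theorem sum_sq_integral_mul_prod_gaussian_le (D : ℕ) {g : (Fin d → ℝ) → ℝ}
    (hg : MemLp g 2 (gaussian d)) :
    ∑ S : Finset.powersetCard D (Finset.univ : Finset (Fin d)),
      (∫ x, g x * ∏ s ∈ S.1, x s ∂(gaussian d)) ^ 2 ≤ ∫ x, g x ^ 2 ∂(gaussian d) := by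
  have horth : ∀ S T : Finset.powersetCard D (Finset.univ : Finset (Fin d)),
      ∫ x, (∏ s ∈ S.1, x s) * ∏ s ∈ T.1, x s ∂(gaussian d) = if S = T then 1 else 0 := by
    intro S T
    rw [integral_prod_mul_prod_gaussian]
    simp only [Subtype.ext_iff]
  exact sum_sq_integral_mul_le (fun S : Finset.powersetCard D (Finset.univ : Finset (Fin d)) =>
    memLp_prod_gaussian S.1) horth hg

end Bessel

/-! ### Isotropy and the dimension-counting bound -/

section LowerBound

variable {P d : ℕ}

/-- The tensor `B` contracted with copies of `M`, restricted to increasing multi-indices. -/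
noncomputable def multilinearPart {D : ℕ} (B : (Fin D → Fin P) → ℝ) (M : Matrix (Fin P) (Fin d) ℝ) :
    EuclideanSpace ℝ (Finset.powersetCard D (Finset.univ : Finset (Fin d))) :=
  WithLp.toLp 2 fun S =>
    contraction B M (S.1.orderEmbOfFin (Finset.mem_powersetCard_univ.1 S.2))

/-- The covariance is `σ` times the identity: two distinct sets of equal size differ by an element
`s` of the first outside the second, and flipping column `s` kills their correlation. -/
theorem integral_inner_multilinearPart_sq {D : ℕ} (hPd : P ≤ d) (B : (Fin D → Fin P) → ℝ) {σ : ℝ}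
    (hσ : ∀ i : Fin D → Fin d, Function.Injective i →
      ∫ M, contraction B M i ^ 2 ∂(uniformSemiOrthogonal hPd) = σ)
    (w : EuclideanSpace ℝ (Finset.powersetCard D (Finset.univ : Finset (Fin d)))) :
    ∫ M, inner ℝ w (multilinearPart B M) ^ 2 ∂(uniformSemiOrthogonal hPd) = σ * ‖w‖ ^ 2 := by
  have hinj : ∀ S : Finset.powersetCard D (Finset.univ : Finset (Fin d)), Function.Injective
      (S.1.orderEmbOfFin (Finset.mem_powersetCard_univ.1 S.2)) := fun S => RelEmbedding.injective _
  have hoff : ∀ S T : Finset.powersetCard D (Finset.univ : Finset (Fin d)), S ≠ T →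
      ∫ M, multilinearPart B M S * multilinearPart B M T ∂(uniformSemiOrthogonal hPd) = 0 := by
    intro S T hST
    have hcS := Finset.mem_powersetCard_univ.1 S.2
    have hcT := Finset.mem_powersetCard_univ.1 T.2
    obtain ⟨s, hsS, hsT⟩ : ∃ s ∈ S.1, s ∉ T.1 := by
      by_contra! hsub
      exact hST (Subtype.ext (Finset.eq_of_subset_of_card_le hsub (hcT.trans hcS.symm).le))
    obtain ⟨k₀, hk₀⟩ : s ∈ Set.range (S.1.orderEmbOfFin hcS) := by
      rw [Finset.range_orderEmbOfFin]
      exact hsS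
    refine integral_contraction_mul_eq_zero hPd B (hinj S) k₀ fun k hk => hsT ?_
    rw [← hk₀, ← hk]
    exact Finset.orderEmbOfFin_mem _ _ _
  have hcont : ∀ S : Finset.powersetCard D (Finset.univ : Finset (Fin d)),
      Continuous fun M : Matrix (Fin P) (Fin d) ℝ => multilinearPart B M S :=
    fun S => continuous_contraction B _
  have hint : ∀ S T, Integrable (fun M : Matrix (Fin P) (Fin d) ℝ =>
      w S * w T * (multilinearPart B M S * multilinearPart B M T))
      (uniformSemiOrthogonal hPd) := fun S T => integrable_uniformSemiOrthogonal hPd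
    (continuous_const.mul ((hcont S).mul (hcont T)))
  have hexp : ∀ M : Matrix (Fin P) (Fin d) ℝ, inner ℝ w (multilinearPart B M) ^ 2
      = ∑ S, ∑ T, w S * w T * (multilinearPart B M S * multilinearPart B M T) := by
    intro M
    rw [PiLp.inner_apply, sq, Finset.sum_mul_sum]
    refine Finset.sum_congr rfl fun S _ => Finset.sum_congr rfl fun T _ => ?_
    simp only [RCLike.inner_apply, conj_trivial]
    ring
  simp only [hexp]
  rw [integral_finsetSum _ fun S _ => integrable_finsetSum _ fun T _ => hint S T,
    EuclideanSpace.real_norm_sq_eq, Finset.mul_sum]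
  refine Finset.sum_congr rfl fun S _ => ?_
  rw [integral_finsetSum _ fun T _ => hint S T, Finset.sum_eq_single S]
  · rw [integral_const_mul]
    have := hσ _ (hinj S)
    simp only [sq] at this ⊢
    rw [mul_comm σ]
    congr 1
  · intro T _ hT
    rw [integral_const_mul, hoff S T hT.symm, mul_zero]
  · simp

variable {H : Type*} [NormedAddCommGroup H] [InnerProductSpace ℝ H]

/-- The vectors of `V` whose linear functional of the features is square integrable. -/
def squareIntegrable (ψ : (Fin d → ℝ) → H) (V : Submodule ℝ H) : Submodule ℝ V where
  carrier := {a | MemLp (fun x => inner ℝ (a : H) (ψ x)) 2 (gaussian d)}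
  add_mem' ha hb := by
    simp only [Set.mem_ofPred_eq, Submodule.coe_add, inner_add_left]
    exact MemLp.add ha hb
  zero_mem' := by simp
  smul_mem' r a ha := by
    simp only [Set.mem_ofPred_eq, Submodule.coe_smul, real_inner_smul_left]
    exact MemLp.const_mul ha r

/-- The coefficients of the predictors in `V` along the multilinear monomials of degree `D`. -/
noncomputable def multilinearCoeff (D : ℕ) (ψ : (Fin d → ℝ) → H) (V : Submodule ℝ H) :
    squareIntegrable ψ V →ₗ[ℝ]
      EuclideanSpace ℝ (Finset.powersetCard D (Finset.univ : Finset (Fin d))) where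
  toFun a := WithLp.toLp 2 fun S => ∫ x, inner ℝ (a : H) (ψ x) * ∏ s ∈ S.1, x s ∂(gaussian d)
  map_add' a b := by
    ext S
    simp only [Submodule.coe_add, inner_add_left, add_mul, PiLp.add_apply]
    exact integral_add (a.2.integrable_mul (memLp_prod_gaussian S.1))
      (b.2.integrable_mul (memLp_prod_gaussian S.1))
  map_smul' r a := by
    ext S
    simp [real_inner_smul_left, mul_assoc, integral_const_mul]

/-- The vectors `w j` do not see the coefficients of the predictor, so they test target and residual
alike; Bessel is then applied twice, in coefficient space and in `L²`. An infinite risk is trivial,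
and a finite one makes the residual, hence the predictor, square integrable. -/
theorem sum_inner_sq_le_lintegral (c : (Fin P → ℕ) →₀ ℝ) {M : Matrix (Fin P) (Fin d) ℝ}
    {ψ : (Fin d → ℝ) → H} (hψ : ∀ a : H, Measurable fun x => inner ℝ a (ψ x))
    (V : Submodule ℝ H) {a : H} (ha : a ∈ V) {ι : Type*} [Fintype ι]
    {w : ι → EuclideanSpace ℝ
      (Finset.powersetCard (hermiteDegree c) (Finset.univ : Finset (Fin d)))}
    (hw : Orthonormal ℝ w)
    (hwV : ∀ j, w j ∈ (LinearMap.range (multilinearCoeff (hermiteDegree c) ψ V))ᗮ) :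
    ENNReal.ofReal (∑ j, inner ℝ (w j) (multilinearPart (leadingTensor c) M) ^ 2)
      ≤ ∫⁻ z, ENNReal.ofReal ((target c M z - inner ℝ a (ψ z)) ^ 2) ∂(gaussian d) := by
  by_cases htop : ∫⁻ z, ENNReal.ofReal ((target c M z - inner ℝ a (ψ z)) ^ 2) ∂(gaussian d) = ⊤
  · rw [htop]
    exact le_top
  have hres : MemLp (fun z => target c M z - inner ℝ a (ψ z)) 2 (gaussian d) := by
    have hmeas : AEStronglyMeasurable (fun z => target c M z - inner ℝ a (ψ z)) (gaussian d) :=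
      (memLp_target c M).1.sub (hψ a).aestronglyMeasurable
    refine (memLp_two_iff_integrable_sq hmeas).2 ⟨hmeas.pow 2, ?_⟩
    rw [hasFiniteIntegral_iff_ofReal (Filter.Eventually.of_forall fun z => sq_nonneg _)]
    exact lt_top_iff_ne_top.2 htop
  have hpred : MemLp (fun z => inner ℝ a (ψ z)) 2 (gaussian d) := by
    refine ((memLp_target c M).sub hres).ae_eq (Filter.Eventually.of_forall fun z => ?_)
    simp
  rw [← ofReal_integral_eq_lintegral_ofReal hres.integrable_sq
    (Filter.Eventually.of_forall fun z => sq_nonneg _)]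
  refine ENNReal.ofReal_le_ofReal ?_
  set u := multilinearCoeff (hermiteDegree c) ψ V ⟨⟨a, ha⟩, hpred⟩ with hu
  have hwu : ∀ j, inner ℝ (w j) (multilinearPart (leadingTensor c) M)
      = inner ℝ (w j) (multilinearPart (leadingTensor c) M - u) := by
    intro j
    rw [inner_sub_right, Submodule.inner_left_of_mem_orthogonal (LinearMap.mem_range_self _ _) (hwV j), sub_zero]
  have hdiff : ∀ S, (multilinearPart (leadingTensor c) M - u) S
      = ∫ z, (target c M z - inner ℝ a (ψ z)) * ∏ s ∈ S.1, z s ∂(gaussian d) := by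
    intro S
    have hS := Finset.mem_powersetCard_univ.1 S.2
    have h1 : Integrable (fun z => target c M z * ∏ s ∈ S.1, z s) (gaussian d) :=
      (memLp_target c M).integrable_mul (memLp_prod_gaussian S.1)
    have h2 : Integrable (fun z => inner ℝ a (ψ z) * ∏ s ∈ S.1, z s) (gaussian d) :=
      hpred.integrable_mul (memLp_prod_gaussian S.1)
    simp only [sub_mul]
    rw [integral_sub h1 h2, PiLp.sub_apply]
    congr 1
    have hprod : ∀ z : Fin d → ℝ, ∏ s ∈ S.1, z s = ∏ k, z (S.1.orderEmbOfFin hS k) := by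
      intro z
      conv_lhs => rw [← Finset.map_orderEmbOfFin_univ S.1 hS]
      rw [Finset.prod_map]
      rfl
    simp only [hprod]
    exact (integral_target_mul_prod c M (RelEmbedding.injective _)).symm
  calc ∑ j, inner ℝ (w j) (multilinearPart (leadingTensor c) M) ^ 2
      ≤ ‖multilinearPart (leadingTensor c) M - u‖ ^ 2 := by
        simp only [hwu]
        have := hw.sum_inner_products_le (s := Finset.univ)
          (multilinearPart (leadingTensor c) M - u)
        simpa only [Real.norm_eq_abs, sq_abs] using this
    _ ≤ ∫ z, (target c M z - inner ℝ a (ψ z)) ^ 2 ∂(gaussian d) := by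
        rw [EuclideanSpace.real_norm_sq_eq]
        simp only [hdiff]
        exact sum_sq_integral_mul_prod_gaussian_le (hermiteDegree c) hres

theorem ofReal_choose_sub_mul_le_lintegral (hPd : P ≤ d) (c : (Fin P → ℕ) →₀ ℝ) {σ : ℝ}
    (hσ : ∀ i : Fin (hermiteDegree c) → Fin d, Function.Injective i →
      ∫ M, contraction (leadingTensor c) M i ^ 2 ∂(uniformSemiOrthogonal hPd) = σ)
    (hσ0 : 0 ≤ σ) {ψ : (Fin d → ℝ) → H} (hψ : ∀ a : H, Measurable fun x => inner ℝ a (ψ x))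
    (V : Submodule ℝ H) [FiniteDimensional ℝ V] (a : Matrix (Fin P) (Fin d) ℝ → H)
    (ha : ∀ M : Matrix (Fin P) (Fin d) ℝ, M * M.transpose = 1 → a M ∈ V) :
    ENNReal.ofReal ((d.choose (hermiteDegree c) - Module.finrank ℝ V) * σ)
      ≤ ∫⁻ M, ∫⁻ z, ENNReal.ofReal ((target c M z - inner ℝ (a M) (ψ z)) ^ 2)
        ∂(gaussian d) ∂(uniformSemiOrthogonal hPd) := by
  set U := LinearMap.range (multilinearCoeff (hermiteDegree c) ψ V) with hU
  set w : Fin (Module.finrank ℝ Uᗮ) → EuclideanSpace ℝ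
    (Finset.powersetCard (hermiteDegree c) (Finset.univ : Finset (Fin d))) :=
    fun j => stdOrthonormalBasis ℝ Uᗮ j with hw
  have hwo : Orthonormal ℝ w := (stdOrthonormalBasis ℝ Uᗮ).orthonormal.comp_linearIsometry
    Uᗮ.subtypeₗᵢ
  have hcont : ∀ j, Continuous fun M : Matrix (Fin P) (Fin d) ℝ =>
      inner ℝ (w j) (multilinearPart (leadingTensor c) M) ^ 2 := by
    intro j
    refine (continuous_const.inner ?_).pow 2
    exact (PiLp.continuous_toLp 2 _).comp
      (continuous_pi fun S => continuous_contraction (leadingTensor c) _)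
  have hsum : ∫ M, ∑ j, inner ℝ (w j) (multilinearPart (leadingTensor c) M) ^ 2
      ∂(uniformSemiOrthogonal hPd) = Module.finrank ℝ Uᗮ * σ := by
    rw [integral_finsetSum _ fun j _ => integrable_uniformSemiOrthogonal hPd (hcont j)]
    simp [integral_inner_multilinearPart_sq hPd _ hσ, hwo.1]
  have hdim : (d.choose (hermiteDegree c) : ℝ) - Module.finrank ℝ V ≤ Module.finrank ℝ Uᗮ := by
    have h1 := U.finrank_add_finrank_orthogonal
    have h2 : Module.finrank ℝ U ≤ Module.finrank ℝ V :=
      (LinearMap.finrank_range_le _).trans (Submodule.finrank_le _)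
    rw [finrank_euclideanSpace, Fintype.card_coe, Finset.card_powersetCard, Finset.card_univ,
      Fintype.card_fin] at h1
    have h3 : d.choose (hermiteDegree c) ≤ Module.finrank ℝ Uᗮ + Module.finrank ℝ V := by omega
    rw [sub_le_iff_le_add]
    exact_mod_cast h3
  calc _ ≤ ENNReal.ofReal (Module.finrank ℝ Uᗮ * σ) :=
        ENNReal.ofReal_le_ofReal (mul_le_mul_of_nonneg_right hdim hσ0)
    _ = ∫⁻ M, ENNReal.ofReal (∑ j, inner ℝ (w j) (multilinearPart (leadingTensor c) M) ^ 2)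
        ∂(uniformSemiOrthogonal hPd) := by
        rw [← hsum, ofReal_integral_eq_lintegral_ofReal]
        · exact integrable_uniformSemiOrthogonal hPd (continuous_finsetSum _ fun j _ => hcont j)
        · exact Filter.Eventually.of_forall fun M => Finset.sum_nonneg fun j _ => sq_nonneg _
    _ ≤ _ := by
        -- Only the lower bound is measurable in `M`; the risk itself need not be, and monotonicity
        -- does not require it.
        refine lintegral_mono_ae ?_
        filter_upwards [ae_mul_transpose_eq_one hPd] with M hM
        exact sum_inner_sq_le_lintegral c hψ V (ha M hM) hwo fun j => Submodule.coe_mem _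

end LowerBound

/-! ### Small dimensions and numerical bounds -/

section NullPredictor

variable {P d : ℕ}

instance instIsOpenPosMeasureGaussian (d : ℕ) : (gaussian d).IsOpenPosMeasure := by
  have : (gaussianReal 0 1).IsOpenPosMeasure :=
    (gaussianReal_absolutelyContinuous' 0 one_ne_zero).isOpenPosMeasure
  unfold gaussian
  infer_instance

theorem continuous_target (c : (Fin P → ℕ) →₀ ℝ) :
    Continuous fun q : Matrix (Fin P) (Fin d) ℝ × (Fin d → ℝ) => target c q.1 q.2 := by
  have h : Continuous fun z : Fin P → ℝ => hermiteSum c z := by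
    simp only [← eval_hermitePolynomial]
    exact MvPolynomial.continuous_eval _
  exact h.comp (continuous_fst.matrix_mulVec continuous_snd)

theorem measurable_target_sq (c : (Fin P → ℕ) →₀ ℝ) (M : Matrix (Fin P) (Fin d) ℝ) :
    Measurable fun x => ENNReal.ofReal (target c M x ^ 2) := by
  simp only [target_eq_eval]
  exact ((MvPolynomial.continuous_eval _).pow 2).measurable.ennreal_ofReal

theorem exists_target_ne_zero {c : (Fin P → ℕ) →₀ ℝ} (hc : c ≠ 0)
    {M : Matrix (Fin P) (Fin d) ℝ} (hM : M * M.transpose = 1) : ∃ x, target c M x ≠ 0 := by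
  by_contra! h
  obtain ⟨m, -, hm⟩ := exists_coeff_hermitePolynomial_ne_zero hc
  refine hm ?_
  have : hermitePolynomial c = 0 := by
    refine MvPolynomial.funext fun z => ?_
    have hz := h (M.transpose.mulVec z)
    rwa [target, Matrix.mulVec_mulVec, hM, Matrix.one_mulVec, ← eval_hermitePolynomial,
      ← map_zero (MvPolynomial.eval z)] at hz
  rw [this, MvPolynomial.coeff_zero]

theorem measurable_lintegral_target_sq (c : (Fin P → ℕ) →₀ ℝ) :
    Measurable fun M : Matrix (Fin P) (Fin d) ℝ =>
      ∫⁻ z, ENNReal.ofReal (target c M z ^ 2) ∂(gaussian d) := by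
  have : SecondCountableTopology (Matrix (Fin P) (Fin d) ℝ) :=
    inferInstanceAs (SecondCountableTopology (Fin P → Fin d → ℝ))
  have hmeas : Measurable fun q : Matrix (Fin P) (Fin d) ℝ × (Fin d → ℝ) =>
      ENNReal.ofReal (target c q.1 q.2 ^ 2) :=
    (((continuous_target c).pow 2).measurable).ennreal_ofReal
  exact hmeas.lintegral_prod_right'

/-- Otherwise some semi-orthogonal `M` gives a continuous target vanishing almost everywhere. The
Gaussian charges every nonempty open set, so the target vanishes identically, which is impossible
because `M` is onto and the polynomial is nonzero. -/
theorem lintegral_target_sq_pos {c : (Fin P → ℕ) →₀ ℝ} (hc : c ≠ 0) (hPd : P ≤ d) :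
    0 < ∫⁻ M, ∫⁻ z, ENNReal.ofReal (target c M z ^ 2) ∂(gaussian d)
      ∂(uniformSemiOrthogonal hPd) := by
  refine pos_iff_ne_zero.2 fun h0 => ?_
  have h1 := (lintegral_eq_zero_iff (measurable_lintegral_target_sq c)).1 h0
  obtain ⟨M, hM0, hM⟩ := (Filter.Eventually.and h1 (ae_mul_transpose_eq_one hPd)).exists
  have hcont : Continuous (target c M) := by
    rw [show target c M = _ from funext (target_eq_eval c M)]
    exact MvPolynomial.continuous_eval _
  have hz := (lintegral_eq_zero_iff (measurable_target_sq c M)).1 hM0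
  have hae : target c M =ᵐ[gaussian d] fun _ => (0 : ℝ) := by
    filter_upwards [hz] with x hx
    have hx' : target c M x ^ 2 ≤ 0 := ENNReal.ofReal_eq_zero.1 hx
    exact (pow_eq_zero_iff two_ne_zero).1 (le_antisymm hx' (sq_nonneg _))
  obtain ⟨x, hx⟩ := exists_target_ne_zero hc hM
  exact hx (congrFun ((hcont.ae_eq_iff_eq _ continuous_const).1 hae) x)

theorem exists_le_lintegral_target_sq {c : (Fin P → ℕ) →₀ ℝ} (hc : c ≠ 0) (d₀ : ℕ) :
    ∃ r > (0 : ℝ), ∀ (d : ℕ) (hPd : P ≤ d), d < d₀ →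
      ENNReal.ofReal r ≤ ∫⁻ M, ∫⁻ z, ENNReal.ofReal (target c M z ^ 2) ∂(gaussian d)
        ∂(uniformSemiOrthogonal hPd) := by
  induction d₀ with
  | zero => exact ⟨1, one_pos, fun d _ hd => absurd hd (Nat.not_lt_zero d)⟩
  | succ d₀ ih =>
    obtain ⟨r, hr, hle⟩ := ih
    by_cases hPd₀ : P ≤ d₀
    · obtain ⟨r', hr'0, hr'⟩ := ENNReal.lt_iff_exists_nnreal_btwn.1
        (lintegral_target_sq_pos hc hPd₀)
      refine ⟨min r r', lt_min hr (by exact_mod_cast hr'0), fun d hPd hd => ?_⟩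
      rcases Nat.lt_succ_iff_lt_or_eq.1 hd with h | rfl
      · exact (ENNReal.ofReal_le_ofReal (min_le_left _ _)).trans (hle d hPd h)
      · refine (ENNReal.ofReal_le_ofReal (min_le_right _ _)).trans ?_
        rw [ENNReal.ofReal_coe_nnreal]
        exact hr'.le
    · refine ⟨r, hr, fun d hPd hd => hle d hPd ?_⟩
      rcases Nat.lt_succ_iff_lt_or_eq.1 hd with h | rfl
      · exact h
      · exact absurd hPd hPd₀

theorem pow_hermiteDegree_pos (c : (Fin P → ℕ) →₀ ℝ) (hPd : P ≤ d) :
    0 < (d : ℝ) ^ hermiteDegree c := by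
  -- For `d = 0` also `P = 0`, so the degree is `0` and the power is `0 ^ 0 = 1`.
  rcases Nat.eq_zero_or_pos d with rfl | hd
  · obtain rfl : P = 0 := Nat.le_zero.1 hPd
    have : hermiteDegree c = 0 := by
      simp [hermiteDegree]
    simp [this]
  · positivity

theorem pow_le_choose_mul {D : ℕ} (hd : 2 * D ≤ d) :
    (d : ℝ) ^ D ≤ 2 ^ D * D.factorial * d.choose D := by
  have h1 : (d + 1 - D) ^ D ≤ D.factorial * d.choose D := by
    rw [← Nat.descFactorial_eq_factorial_mul_choose]
    exact Nat.pow_sub_le_descFactorial d D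
  have h2 : d ^ D ≤ 2 ^ D * (D.factorial * d.choose D) := by
    calc d ^ D ≤ (2 * (d + 1 - D)) ^ D := Nat.pow_le_pow_left (by omega) D
      _ = 2 ^ D * (d + 1 - D) ^ D := mul_pow _ _ _
      _ ≤ _ := Nat.mul_le_mul_left _ h1
  rw [mul_assoc]
  exact_mod_cast h2

end NullPredictor

end LinearLowerBound

/-! ### Choice of constants and conclusion -/

open LinearLowerBound in
theorem mainTheorem8 {P : ℕ} (hhat : (Fin P → ℕ) →₀ ℝ) (hhat_ne : hhat ≠ 0) :
    ∃ c > (0 : ℝ), ∃ C > (0 : ℝ),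
      ∀ (d n : ℕ) (hPd : P ≤ d)
        (H : Type*) [NormedAddCommGroup H] [InnerProductSpace ℝ H] [CompleteSpace H]
        (ψ : (Fin d → ℝ) → H) (_ : ∀ a : H, Measurable fun x => inner ℝ a (ψ x))
        (L : (Fin n → ℝ × ℝ) → WithTop ℝ) (lam : ℝ) (_ : 0 < lam)
        (x : Fin n → Fin d → ℝ) (ε : Matrix (Fin P) (Fin d) ℝ → Fin n → ℝ)
        (ahat : Matrix (Fin P) (Fin d) ℝ → H)
        (_ : ∀ M : Matrix (Fin P) (Fin d) ℝ, M * M.transpose = 1 →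
          IsLinearMethodOutput ψ L lam x (fun i => target hhat M (x i) + ε M i) (ahat M)),
        ENNReal.ofReal
            (c - C * ((min (n : Cardinal) (Module.rank ℝ H)).toNat : ℝ)
              * (d : ℝ) ^ (-(hermiteDegree hhat : ℤ)))
          ≤ ∫⁻ M, ∫⁻ z, ENNReal.ofReal ((target hhat M z - inner ℝ (ahat M) (ψ z)) ^ 2)
              ∂(gaussian d) ∂(uniformSemiOrthogonal hPd) := by
  set D := hermiteDegree hhat with hD
  obtain ⟨c₁, hc₁, d₁, hlarge⟩ :=
    exists_le_integral_contraction_sq _ (exists_leadingTensor_ne_zero hhat_ne)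
  obtain ⟨c₂, hc₂, hsmall⟩ := exists_le_lintegral_target_sq hhat_ne (max d₁ (2 * D))
  set d₀ := max d₁ (2 * D) with hd₀
  -- `c₂` serves the null predictor for `d < d₀`; the other term turns `d ^ D ≤ 2 ^ D * D! *
  -- d.choose D` into `c * d ^ D ≤ c₁ * d.choose D`.
  set c := min c₂ (c₁ / (2 ^ D * D.factorial)) with hc
  have hcpos : 0 < c := lt_min hc₂ (by positivity)
  -- The summand `c₁` pays for `dim V` when `d ≥ d₀`; the summand `c * d₀ ^ D` makes the bound
  -- nonpositive when `d < d₀` and `m ≥ 1`.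
  refine ⟨c, hcpos, c₁ + c * d₀ ^ D, by positivity,
    fun d n hPd H _ _ _ ψ hψ L lam hlam x ε ahat hout => ?_⟩
  set m := (min (n : Cardinal) (Module.rank ℝ H)).toNat with hm
  set V := Submodule.span ℝ (Set.range fun i => ψ (x i)) with hV
  have hfin : FiniteDimensional ℝ V := FiniteDimensional.span_of_finite ℝ (Set.finite_range _)
  have hVm : Module.finrank ℝ V ≤ m := finrank_span_range_le _
  have hmem : ∀ M : Matrix (Fin P) (Fin d) ℝ, M * M.transpose = 1 → ahat M ∈ V :=
    fun M hM => (hout M hM).mem_span hlam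
  have hpow : 0 < (d : ℝ) ^ D := pow_hermiteDegree_pos hhat hPd
  rw [zpow_neg, zpow_natCast]
  rcases lt_or_ge d d₀ with hd | hd
  · rcases Nat.eq_zero_or_pos m with hm0 | hmpos
    · have hV0 : V = ⊥ := Submodule.finrank_eq_zero.1 (by omega)
      rw [hm0, Nat.cast_zero, mul_zero, zero_mul, sub_zero]
      refine (ENNReal.ofReal_le_ofReal (min_le_left _ _)).trans ((hsmall d hPd hd).trans ?_)
      refine lintegral_mono_ae ?_
      filter_upwards [ae_mul_transpose_eq_one hPd] with M hM
      have h0 : ahat M = 0 := by simpa [hV0] using hmem M hM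
      simp [h0]
    · rw [ENNReal.ofReal_of_nonpos]
      · exact zero_le
      · rw [sub_nonpos, ← div_eq_mul_inv, le_div_iff₀ hpow]
        have h1 : (d : ℝ) ^ D ≤ (d₀ : ℝ) ^ D :=
          pow_le_pow_left₀ (Nat.cast_nonneg d) (by exact_mod_cast hd.le) D
        have h2 : (1 : ℝ) ≤ m := by exact_mod_cast hmpos
        calc c * (d : ℝ) ^ D ≤ c * (d₀ : ℝ) ^ D := mul_le_mul_of_nonneg_left h1 hcpos.le
          _ ≤ c₁ + c * (d₀ : ℝ) ^ D := by linarith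
          _ ≤ (c₁ + c * (d₀ : ℝ) ^ D) * m := le_mul_of_one_le_right (by positivity) h2
  · have hDd : 2 * D ≤ d := (le_max_right _ _).trans hd
    obtain ⟨i₀, hi₀⟩ : ∃ i : Fin D → Fin d, Function.Injective i :=
      ⟨Fin.castLE (by omega), Fin.castLE_injective _⟩
    have hσ := hlarge d hPd i₀ hi₀ ((le_max_left _ _).trans hd)
    set σ := ∫ M, contraction (leadingTensor hhat) M i₀ ^ 2 ∂(uniformSemiOrthogonal hPd) with hσdef
    have hσ0 : 0 ≤ σ := MeasureTheory.integral_nonneg fun M => sq_nonneg _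
    -- The alternative of a nonpositive left side is needed when `dim V` exceeds `d.choose D`: the
    -- lower bound on `σ` cannot be multiplied by a negative factor.
    refine le_trans (ENNReal.ofReal_le_ofReal_iff'.2 ?_)
      (ofReal_choose_sub_mul_le_lintegral hPd hhat
        (fun i hi => integral_contraction_sq_eq hPd _ hi hi₀) hσ0 hψ V ahat hmem)
    have hVm' : (Module.finrank ℝ V : ℝ) ≤ m := by exact_mod_cast hVm
    have hchoose : c * (d : ℝ) ^ D ≤ c₁ * d.choose D := by
      calc c * (d : ℝ) ^ D ≤ c₁ / (2 ^ D * D.factorial) * (2 ^ D * D.factorial * d.choose D) :=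
            mul_le_mul (min_le_right _ _) (pow_le_choose_mul hDd) hpow.le (by positivity)
        _ = c₁ * d.choose D := by field_simp
    have hlow : c - (c₁ + c * d₀ ^ D) * m * ((d : ℝ) ^ D)⁻¹
        ≤ c₁ * ((d.choose D - Module.finrank ℝ V) * ((d : ℝ) ^ D)⁻¹) := by
      rw [← mul_assoc, ← div_eq_mul_inv, ← div_eq_mul_inv, le_div_iff₀ hpow, sub_mul,
        div_mul_cancel₀ _ hpow.ne']
      have : c₁ * Module.finrank ℝ V ≤ (c₁ + c * d₀ ^ D) * m := by
        refine mul_le_mul ?_ hVm' (Nat.cast_nonneg _) (by positivity)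
        exact le_add_of_nonneg_right (by positivity)
      linarith
    rcases le_total ((d.choose D : ℝ) - Module.finrank ℝ V) 0 with hneg | hpos
    · right
      refine hlow.trans ?_
      exact mul_nonpos_of_nonneg_of_nonpos hc₁.le
        (mul_nonpos_of_nonpos_of_nonneg hneg (by positivity))
    · left
      refine hlow.trans ?_
      rw [mul_left_comm]
      refine mul_le_mul_of_nonneg_left ?_ hpos
      rw [← div_eq_mul_inv, div_le_iff₀ hpow, mul_comm]
      exact hσ
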